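/- Corollary (Willmore inequality). Let $n\ge 3$ and let $\Omega\subset\mathbb{R}^n$ be a bounded, convex domain (nonempty, open) with smooth ($C^\infty$) boundary. For $x\in\partial\Omega$ let $H(x)$ be the mean curvature of $\partial\Omega$ at $x$ with respect to the exterior unit normal $\nu$, i.e. the sum of the principal curvatures (the trace of $v\mapsto D_v\nu$ on the tangent space $T_x\partial\Omega$), and let $\sigma$ be the $(n-1)$-dimensional surface measure (Hausdorff measure $\mathcal{H}^{n-1}$, with the Euclidean normalization). Then \[ |\mathbb{S}^{n-1}|\le\int_{\partial\Omega}\left(\frac{H}{n-1}\right)^{n-1}d\sigma, \] where $|\mathbb{S}^{n-1}|=\mathcal{H}^{n-1}(\mathbb{S}^{n-1})$ is the area of the unit sphere. Moreover, equality holds if and only if $\Omega$ is a ball. -/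

import Mathlib

open MeasureTheory
open scoped ContDiff

noncomputable section

namespace SmoothDomain

variable {n : ℕ}

/-- `φ` is a smooth local defining function of `Ω` on the open neighbourhood `U` of `x`:
`Ω ∩ U = {φ < 0}` and the gradient of `φ` does not vanish on `U`. -/
structure IsLocalDefiningFunction (Ω : Set (EuclideanSpace ℝ (Fin n)))
    (x : EuclideanSpace ℝ (Fin n)) (U : Set (EuclideanSpace ℝ (Fin n)))
    (φ : EuclideanSpace ℝ (Fin n) → ℝ) : Prop where
  isOpen : IsOpen U
  mem : x ∈ U
  contDiffOn : ContDiffOn ℝ ∞ φ U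
  gradient_ne_zero : ∀ y ∈ U, gradient φ y ≠ 0
  inter_eq : Ω ∩ U = {y ∈ U | φ y < 0}

/-- The boundary of `Ω` is smooth (of class `C^∞`, with `Ω` locally on one side of it). -/
def HasSmoothBoundary (Ω : Set (EuclideanSpace ℝ (Fin n))) : Prop :=
  ∀ x ∈ frontier Ω, ∃ U φ, IsLocalDefiningFunction Ω x U φ

/-- `ν` is the exterior unit normal of `Ω` at the boundary point `x`. -/
def IsOuterUnitNormal (Ω : Set (EuclideanSpace ℝ (Fin n)))
    (x ν : EuclideanSpace ℝ (Fin n)) : Prop :=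
  x ∈ frontier Ω ∧ ∃ U φ, IsLocalDefiningFunction Ω x U φ ∧ ν = ‖gradient φ x‖⁻¹ • gradient φ x

theorem IsLocalDefiningFunction.apply_eq_zero {Ω U : Set (EuclideanSpace ℝ (Fin n))}
    {x : EuclideanSpace ℝ (Fin n)} {φ : EuclideanSpace ℝ (Fin n) → ℝ}
    (h : IsLocalDefiningFunction Ω x U φ) (hx : x ∈ frontier Ω) : φ x = 0 := by
  have hc : ContinuousAt φ x :=
    h.contDiffOn.continuousOn.continuousAt (h.isOpen.mem_nhds h.mem)
  rw [frontier_eq_closure_inter_closure] at hx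
  rcases lt_trichotomy (φ x) 0 with h0 | h0 | h0
  · obtain ⟨y, hy, hy'⟩ := mem_closure_iff_nhds.1 hx.2 _
      (Filter.inter_mem (hc.eventually_lt_const h0) (h.isOpen.mem_nhds h.mem))
    exact absurd (h.inter_eq ▸ (⟨hy.2, hy.1⟩ : y ∈ {y ∈ U | φ y < 0}) : y ∈ Ω ∩ U).1 hy'
  · exact h0
  · obtain ⟨y, hy, hy'⟩ := mem_closure_iff_nhds.1 hx.1 _
      (Filter.inter_mem (hc.eventually_const_lt h0) (h.isOpen.mem_nhds h.mem))
    have : y ∈ {y ∈ U | φ y < 0} := h.inter_eq ▸ ⟨hy', hy.2⟩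
    exact absurd this.2 (not_lt.2 hy.1.le)

theorem IsLocalDefiningFunction.hasDerivAt {Ω U : Set (EuclideanSpace ℝ (Fin n))}
    {x : EuclideanSpace ℝ (Fin n)} {φ : EuclideanSpace ℝ (Fin n) → ℝ}
    (h : IsLocalDefiningFunction Ω x U φ) (v : EuclideanSpace ℝ (Fin n)) :
    HasDerivAt (fun t : ℝ => φ (x + t • v)) (inner ℝ (gradient φ x) v) 0 := by
  have hd : DifferentiableAt ℝ φ x :=
    (h.contDiffOn.contDiffAt (h.isOpen.mem_nhds h.mem)).differentiableAt (by simp)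
  have h1 : HasDerivAt (fun t : ℝ => x + t • v) v 0 := by
    simpa using ((hasDerivAt_id (0 : ℝ)).smul_const v).const_add x
  have h2 : HasFDerivAt φ (InnerProductSpace.toDual ℝ _ (gradient φ x)) (x + (0 : ℝ) • v) := by
    simpa using hd.hasGradientAt.hasFDerivAt
  have h3 := h2.comp_hasDerivAt 0 h1
  rw [InnerProductSpace.toDual_apply_apply] at h3
  exact h3

theorem IsLocalDefiningFunction.inner_nonpos {Ω U V : Set (EuclideanSpace ℝ (Fin n))}
    {x : EuclideanSpace ℝ (Fin n)} {φ ψ : EuclideanSpace ℝ (Fin n) → ℝ}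
    (h : IsLocalDefiningFunction Ω x U φ) (h' : IsLocalDefiningFunction Ω x V ψ)
    (hx : x ∈ frontier Ω) {v : EuclideanSpace ℝ (Fin n)} (hv : inner ℝ (gradient φ x) v < 0) :
    inner ℝ (gradient ψ x) v ≤ 0 := by
  have hcont : Filter.Tendsto (fun t : ℝ => x + t • v) (nhdsWithin 0 (Set.Ioi 0)) (nhds x) := by
    have : Continuous fun t : ℝ => x + t • v := by fun_prop
    simpa using this.continuousWithinAt (s := Set.Ioi 0) (x := 0) |>.tendsto
  have e1 : ∀ᶠ t in nhdsWithin (0 : ℝ) (Set.Ioi 0), φ (x + t • v) < 0 := by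
    have := (h.hasDerivAt v).hasDerivWithinAt (s := Set.Ioi 0)
    rw [hasDerivWithinAt_iff_tendsto_slope' (by simp)] at this
    filter_upwards [this.eventually_lt_const hv, self_mem_nhdsWithin] with t ht ht0
    have ht0 : 0 < t := ht0
    simp only [slope_def_field, zero_smul, add_zero, h.apply_eq_zero hx, sub_zero] at ht
    by_contra hc
    exact absurd ht (not_lt.2 (div_nonneg (not_lt.1 hc) ht0.le))
  have e2 : ∀ᶠ t in nhdsWithin (0 : ℝ) (Set.Ioi 0), ψ (x + t • v) < 0 := by
    filter_upwards [e1, hcont (h.isOpen.mem_nhds h.mem), hcont (h'.isOpen.mem_nhds h'.mem)]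
      with t ht hU hV
    have h1 : x + t • v ∈ Ω ∩ U := by rw [h.inter_eq]; exact ⟨hU, ht⟩
    have h2 : x + t • v ∈ {y ∈ V | ψ y < 0} := by rw [← h'.inter_eq]; exact ⟨h1.1, hV⟩
    exact h2.2
  have := (h'.hasDerivAt v).hasDerivWithinAt (s := Set.Ioi 0)
  rw [hasDerivWithinAt_iff_tendsto_slope' (by simp)] at this
  refine le_of_tendsto this ?_
  filter_upwards [e2, self_mem_nhdsWithin] with t ht ht0
  have ht0 : 0 < t := ht0
  simp only [slope_def_field, zero_smul, add_zero, h'.apply_eq_zero hx, sub_zero]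
  exact div_nonpos_of_nonpos_of_nonneg ht.le ht0.le

/-- The exterior unit normal does not depend on the defining function. -/
theorem IsOuterUnitNormal.unique {Ω : Set (EuclideanSpace ℝ (Fin n))}
    {x ν μ : EuclideanSpace ℝ (Fin n)} (hν : IsOuterUnitNormal Ω x ν)
    (hμ : IsOuterUnitNormal Ω x μ) : ν = μ := by
  obtain ⟨hx, U, φ, h, rfl⟩ := hν
  obtain ⟨-, V, ψ, h', rfl⟩ := hμ
  have ha0 := h.gradient_ne_zero x h.mem
  have hb0 := h'.gradient_ne_zero x h'.mem
  have key : ∀ v, inner ℝ (gradient φ x) v < 0 → inner ℝ (gradient ψ x) v ≤ 0 :=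
    fun v hv => h.inner_nonpos h' hx hv
  generalize gradient φ x = a at *
  generalize gradient ψ x = b at *
  have ha : 0 < ‖a‖ := norm_pos_iff.2 ha0
  have hb : 0 < ‖b‖ := norm_pos_iff.2 hb0
  have hab : ‖a‖ * ‖b‖ ≤ inner ℝ a b := by
    by_contra! hlt
    have hk := key (‖a‖ • b - ‖b‖ • a) (by
      simp only [inner_sub_right, inner_smul_right, real_inner_self_eq_norm_sq]
      nlinarith)
    simp only [inner_sub_right, inner_smul_right, real_inner_self_eq_norm_sq,
      real_inner_comm a b] at hk
    nlinarith [mul_pos hb (sub_pos.2 hlt)]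
  have heq := inner_eq_norm_mul_iff_real.1 (le_antisymm (real_inner_le_norm a b) hab)
  rw [inv_smul_eq_iff₀ ha.ne', smul_comm, eq_inv_smul_iff₀ hb.ne']
  exact heq

open Classical in
/-- The exterior unit normal field of `Ω` (the Gauss map of `∂Ω`); it has the value `0` where no
boundary normal exists. By `IsOuterUnitNormal.unique` it does not depend on the choice made here. -/
def outerNormal (Ω : Set (EuclideanSpace ℝ (Fin n)))
    (x : EuclideanSpace ℝ (Fin n)) : EuclideanSpace ℝ (Fin n) :=
  if h : ∃ ν, IsOuterUnitNormal Ω x ν then h.choose else 0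

/-- The tangent space `T_x ∂Ω`, as the orthogonal complement of the normal. -/
abbrev tangentSpace (Ω : Set (EuclideanSpace ℝ (Fin n)))
    (x : EuclideanSpace ℝ (Fin n)) : Submodule ℝ (EuclideanSpace ℝ (Fin n)) :=
  (Submodule.span ℝ {outerNormal Ω x})ᗮ

/-- The Weingarten map `v ↦ D_v ν` of `∂Ω` at `x`, with respect to the exterior unit normal `ν`.
The derivative is taken along `∂Ω` and only applied to tangent vectors, on which the derivative
within `∂Ω` is uniquely determined. -/
def weingartenMap (Ω : Set (EuclideanSpace ℝ (Fin n))) (x : EuclideanSpace ℝ (Fin n)) :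
    tangentSpace Ω x →L[ℝ] tangentSpace Ω x :=
  (tangentSpace Ω x).orthogonalProjectionOnto ∘L
    fderivWithin ℝ (outerNormal Ω) (frontier Ω) x ∘L (tangentSpace Ω x).subtypeL

/-- The mean curvature of `∂Ω` at `x` with respect to the exterior unit normal: the trace of the
Weingarten map, that is, the sum of the principal curvatures. -/
def meanCurvature (Ω : Set (EuclideanSpace ℝ (Fin n))) (x : EuclideanSpace ℝ (Fin n)) : ℝ :=
  LinearMap.trace ℝ (tangentSpace Ω x) (weingartenMap Ω x).toLinearMap

end SmoothDomain

end

/-!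
# The Willmore inequality for convex domains

The Gauss map `ν` sends the boundary of a bounded domain onto the unit sphere
(`image_outerNormal_frontier`), so the area of the sphere is at most the integral over the boundary
of the absolute Jacobian of `ν`, the determinant of the Weingarten map. For a convex domain the
Weingarten map is symmetric and positive semidefinite, so by the inequality between the arithmetic
and the geometric mean of the principal curvatures its determinant is at most
`(H / (n - 1)) ^ (n - 1)`.

The area formula is only needed as an inequality. Near a boundary point `x` the boundary, and near
`ν x` the sphere, are almost isometric to their common tangent space, where the Gauss map becomes a
map that is approximated by its linearization. Hence `ν` increases areas near `x` by at most a
factor close to the determinant (`exists_measure_image_outerNormal_le`). Compactness turns this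
local estimate into an integral one (`measure_image_le_setLIntegral`).

If equality holds, then the inequality of the means is an equality at every boundary point, since
boundary pieces have positive area (`det_weingartenMap_eq_of_integral_eq`). So the boundary is
totally umbilical. Differentiating `D ν = κ • id` along the boundary and using the symmetry of
second derivatives shows that `κ` is constant (`IsUmbilical.hasFDerivWithinAt_curvature`, together with
`eq_of_hasFDerivWithinAt_zero`). Then `ν - κ • x` is constant as well, which makes the boundary a
sphere and the domain a ball (`IsUmbilical.exists_eq_ball`).

Throughout, the boundary is treated without charts. If `φ` is a local defining function, the
normalized gradient of `φ` extends `ν` smoothly to a neighbourhood, and tangential derivatives of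
functions on the boundary are read off from smooth extensions, because every vector orthogonal to
the normal lies in the tangent cone of the boundary (`mem_tangentConeAt`).
-/

open Filter Topology Set
open scoped NNReal

namespace SmoothDomain

variable {n : ℕ} {Ω U : Set (EuclideanSpace ℝ (Fin n))} {x y : EuclideanSpace ℝ (Fin n)}
  {φ : EuclideanSpace ℝ (Fin n) → ℝ}

/-! ### The local defining function and the normal field -/

/-- The normalized gradient of `φ`: if `φ` is a local defining function of `Ω`, this is a smooth
extension of the outer normal of `Ω` off the boundary. -/
noncomputable def unitGradient (φ : EuclideanSpace ℝ (Fin n) → ℝ)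
    (y : EuclideanSpace ℝ (Fin n)) : EuclideanSpace ℝ (Fin n) :=
  ‖gradient φ y‖⁻¹ • gradient φ y

namespace IsLocalDefiningFunction

theorem center (h : IsLocalDefiningFunction Ω x U φ) (hy : y ∈ U) :
    IsLocalDefiningFunction Ω y U φ :=
  ⟨h.isOpen, hy, h.contDiffOn, h.gradient_ne_zero, h.inter_eq⟩

theorem eventually_add_smul_mem (h : IsLocalDefiningFunction Ω x U φ) (hx : φ x = 0)
    {v : EuclideanSpace ℝ (Fin n)} (hv : inner ℝ (gradient φ x) v < 0) :
    ∀ᶠ t in 𝓝[>] (0 : ℝ), x + t • v ∈ Ω := by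
  have hcont : Tendsto (fun t : ℝ => x + t • v) (𝓝[>] 0) (𝓝 x) := by
    have : Continuous fun t : ℝ => x + t • v := by fun_prop
    simpa using this.continuousWithinAt (s := Ioi 0) (x := 0) |>.tendsto
  have := (h.hasDerivAt v).hasDerivWithinAt (s := Ioi 0)
  rw [hasDerivWithinAt_iff_tendsto_slope' (by simp)] at this
  filter_upwards [this.eventually_lt_const hv, self_mem_nhdsWithin,
    hcont (h.isOpen.mem_nhds h.mem)] with t ht ht0 hU
  have ht0 : 0 < t := ht0
  simp only [slope_def_field, zero_smul, add_zero, hx, sub_zero] at ht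
  have h1 : φ (x + t • v) < 0 := by
    by_contra hc
    exact absurd ht (not_lt.2 (div_nonneg (not_lt.1 hc) ht0.le))
  have h2 : x + t • v ∈ Ω ∩ U := by rw [h.inter_eq]; exact ⟨hU, h1⟩
  exact h2.1

theorem mem_frontier_iff (h : IsLocalDefiningFunction Ω x U φ) (hΩ : IsOpen Ω) (hy : y ∈ U) :
    y ∈ frontier Ω ↔ φ y = 0 := by
  refine ⟨(h.center hy).apply_eq_zero, fun h0 => ?_⟩
  rw [hΩ.frontier_eq]
  refine ⟨?_, fun hyΩ => ?_⟩
  · have hg := h.gradient_ne_zero y hy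
    have hev := (h.center hy).eventually_add_smul_mem h0 (v := -gradient φ y) (by
      rw [inner_neg_right, real_inner_self_eq_norm_sq]
      have := norm_pos_iff.2 hg
      nlinarith)
    have hcont : Tendsto (fun t : ℝ => y + t • (-gradient φ y)) (𝓝[>] 0) (𝓝 y) := by
      have : Continuous fun t : ℝ => y + t • (-gradient φ y) := by fun_prop
      simpa using this.continuousWithinAt (s := Ioi 0) (x := 0) |>.tendsto
    exact mem_closure_of_tendsto hcont hev
  · have : y ∈ {y ∈ U | φ y < 0} := h.inter_eq ▸ ⟨hyΩ, hy⟩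
    exact absurd this.2 (by simp [h0])

theorem outerNormal_eq (h : IsLocalDefiningFunction Ω x U φ) (hx : x ∈ frontier Ω) :
    outerNormal Ω x = unitGradient φ x := by
  have hν : IsOuterUnitNormal Ω x (unitGradient φ x) := ⟨hx, U, φ, h, rfl⟩
  have hex : ∃ ν, IsOuterUnitNormal Ω x ν := ⟨_, hν⟩
  rw [outerNormal, dif_pos hex]
  exact hex.choose_spec.unique hν

theorem norm_unitGradient (h : IsLocalDefiningFunction Ω x U φ) (hy : y ∈ U) :
    ‖unitGradient φ y‖ = 1 := by
  have := norm_pos_iff.2 (h.gradient_ne_zero y hy)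
  rw [unitGradient, norm_smul, norm_inv, norm_norm, inv_mul_cancel₀ this.ne']

theorem gradient_eq_smul_unitGradient (h : IsLocalDefiningFunction Ω x U φ) (hy : y ∈ U) :
    gradient φ y = ‖gradient φ y‖ • unitGradient φ y := by
  have := norm_pos_iff.2 (h.gradient_ne_zero y hy)
  rw [unitGradient, smul_smul, mul_inv_cancel₀ this.ne', one_smul]

theorem contDiffAt (h : IsLocalDefiningFunction Ω x U φ) (hy : y ∈ U) : ContDiffAt ℝ ∞ φ y :=
  h.contDiffOn.contDiffAt (h.isOpen.mem_nhds hy)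

theorem contDiffAt_gradient (h : IsLocalDefiningFunction Ω x U φ) (hy : y ∈ U) :
    ContDiffAt ℝ ∞ (gradient φ) y := by
  have h1 : ContDiffAt ℝ ∞ (fderiv ℝ φ) y := (h.contDiffAt hy).fderiv_right (by simp)
  exact (InnerProductSpace.toDual ℝ (EuclideanSpace ℝ (Fin n))).symm.contDiff.contDiffAt.comp y h1

theorem contDiffAt_inv_norm_gradient (h : IsLocalDefiningFunction Ω x U φ) (hy : y ∈ U) :
    ContDiffAt ℝ ∞ (fun z => ‖gradient φ z‖⁻¹) y :=
  ((h.contDiffAt_gradient hy).norm ℝ (h.gradient_ne_zero y hy)).inv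
    (norm_ne_zero_iff.2 (h.gradient_ne_zero y hy))

theorem contDiffAt_unitGradient (h : IsLocalDefiningFunction Ω x U φ) (hy : y ∈ U) :
    ContDiffAt ℝ ∞ (unitGradient φ) y :=
  (h.contDiffAt_inv_norm_gradient hy).smul (h.contDiffAt_gradient hy)

theorem hasFDerivAt_unitGradient (h : IsLocalDefiningFunction Ω x U φ) (hy : y ∈ U) :
    HasFDerivAt (unitGradient φ) (fderiv ℝ (unitGradient φ) y) y :=
  ((h.contDiffAt_unitGradient hy).differentiableAt (by simp)).hasFDerivAt

/-- The derivative of a unit field is orthogonal to the field. -/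
theorem inner_fderiv_unitGradient (h : IsLocalDefiningFunction Ω x U φ) (hy : y ∈ U)
    (v : EuclideanSpace ℝ (Fin n)) :
    inner ℝ (unitGradient φ y) (fderiv ℝ (unitGradient φ) y v) = 0 := by
  have h1 := (h.hasFDerivAt_unitGradient hy).norm_sq
  have h2 : (fun z => ‖unitGradient φ z‖ ^ 2) =ᶠ[𝓝 y] fun _ => (1 : ℝ) := by
    filter_upwards [h.isOpen.mem_nhds hy] with z hz
    rw [h.norm_unitGradient hz, one_pow]
  have h3 := h1.unique ((hasFDerivAt_const (1 : ℝ) y).congr_of_eventuallyEq h2)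
  have h4 := congrArg (fun L => L v) h3
  simpa using h4

/-- The second fundamental form is symmetric, being the Hessian of `φ` up to a factor. -/
theorem inner_fderiv_unitGradient_comm (h : IsLocalDefiningFunction Ω x U φ) (hy : y ∈ U)
    {u v : EuclideanSpace ℝ (Fin n)} (hu : inner ℝ (unitGradient φ y) u = 0)
    (hv : inner ℝ (unitGradient φ y) v = 0) :
    inner ℝ (fderiv ℝ (unitGradient φ) y u) v = inner ℝ (fderiv ℝ (unitGradient φ) y v) u := by
  have hg : HasFDerivAt (gradient φ) (fderiv ℝ (gradient φ) y) y :=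
    ((h.contDiffAt_gradient hy).differentiableAt (by simp)).hasFDerivAt
  have ha := ((h.contDiffAt_inv_norm_gradient hy).differentiableAt (by simp)).hasFDerivAt
  have hN : fderiv ℝ (unitGradient φ) y = _ := (ha.smul hg).fderiv
  have hsymm : IsSymmSndFDerivAt ℝ φ y := 
    ((h.contDiffAt hy).of_le (m := 2) (WithTop.coe_le_coe.2 le_top)).isSymmSndFDerivAt (by simp)
  have hD : ∀ a b, inner ℝ (fderiv ℝ (gradient φ) y a) b = fderiv ℝ (fderiv ℝ φ) y a b := by
    intro a b
    have h1 : HasFDerivAt (fderiv ℝ φ) (fderiv ℝ (fderiv ℝ φ) y) y :=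
      (((h.contDiffAt hy).fderiv_right (m := ∞) (by simp)).differentiableAt (by simp)).hasFDerivAt
    have h2 : fderiv ℝ (gradient φ) y = _ :=
      ((InnerProductSpace.toDual ℝ (EuclideanSpace ℝ (Fin n))).symm.hasFDerivAt.comp y h1).fderiv
    rw [h2]
    exact InnerProductSpace.toDual_symm_apply
  have key : ∀ w, inner ℝ (unitGradient φ y) w = 0 → inner ℝ (gradient φ y) w = 0 := by
    intro w hw
    rw [h.gradient_eq_smul_unitGradient hy, inner_smul_left, hw, mul_zero]
  rw [hN]
  simp [inner_add_left, inner_smul_left, hD, key u hu, key v hv, hsymm.eq u v]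

end IsLocalDefiningFunction

/-! ### The boundary near a point: a graph over its tangent space -/

theorem eventually_pos_of_hasDerivAt {f : ℝ → ℝ} {a : ℝ} (hf : HasDerivAt f a 0) (h0 : f 0 = 0)
    (ha : 0 < a) : ∀ᶠ t in 𝓝[>] (0 : ℝ), 0 < f t := by
  have := hf.hasDerivWithinAt (s := Ioi 0)
  rw [hasDerivWithinAt_iff_tendsto_slope' (by simp)] at this
  filter_upwards [this.eventually_const_lt ha, self_mem_nhdsWithin] with t ht ht0
  have ht0 : 0 < t := ht0
  simp only [slope_def_field, h0, sub_zero] at ht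
  exact (div_pos_iff_of_pos_right ht0).1 ht

namespace IsLocalDefiningFunction

theorem mem_tangentSpace_iff (h : IsLocalDefiningFunction Ω x U φ) (hx : x ∈ frontier Ω)
    {v : EuclideanSpace ℝ (Fin n)} :
    v ∈ tangentSpace Ω x ↔ inner ℝ (unitGradient φ x) v = 0 := by
  rw [tangentSpace, Submodule.mem_orthogonal_singleton_iff_inner_right, h.outerNormal_eq hx]

/-- Near `x`, the secants of the boundary are almost orthogonal to the normal at `x`. -/
theorem exists_abs_inner_sub_le (h : IsLocalDefiningFunction Ω x U φ)
    {η : ℝ} (hη : 0 < η) :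
    ∃ V ∈ 𝓝 x, ∀ y ∈ V ∩ frontier Ω, ∀ z ∈ V ∩ frontier Ω,
      |inner ℝ (unitGradient φ x) (y - z)| ≤ η * ‖y - z‖ := by
  have hg := norm_pos_iff.2 (h.gradient_ne_zero x h.mem)
  have hs : HasStrictFDerivAt φ (fderiv ℝ φ x) x :=
    (h.contDiffAt h.mem).hasStrictFDerivAt (by simp)
  obtain ⟨s, hs, hap⟩ := hs.approximates_deriv_on_nhds
    (c := (η * ‖gradient φ x‖).toNNReal)
    (Or.inr (Real.toNNReal_pos.2 (mul_pos hη hg)))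
  refine ⟨s ∩ U, inter_mem hs (h.isOpen.mem_nhds h.mem), ?_⟩
  rintro y ⟨⟨hys, hyU⟩, hy⟩ z ⟨⟨hzs, hzU⟩, hz⟩
  have h1 := hap y hys z hzs
  have h2 : fderiv ℝ φ x (y - z) = ‖gradient φ x‖ * inner ℝ (unitGradient φ x) (y - z) := by
    rw [← toDual_gradient, InnerProductSpace.toDual_apply_apply]
    conv_lhs => rw [h.gradient_eq_smul_unitGradient h.mem, inner_smul_left]
    rfl
  rw [(h.center hyU).apply_eq_zero hy, (h.center hzU).apply_eq_zero hz, h2, sub_zero, zero_sub,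
    norm_neg, norm_mul, norm_norm, Real.norm_eq_abs] at h1
  have h3 : ‖gradient φ x‖ * |inner ℝ (unitGradient φ x) (y - z)| ≤
      ‖gradient φ x‖ * (η * ‖y - z‖) := by
    refine h1.trans_eq ?_
    rw [Real.coe_toNNReal _ (by positivity)]
    ring
  exact le_of_mul_le_mul_left h3 hg

/-- Every line parallel to the normal at `x` and close to `x` meets the boundary near `x`, by the
intermediate value theorem. -/
theorem eventually_exists_add_smul_mem_frontier (h : IsLocalDefiningFunction Ω x U φ)
    (hΩ : IsOpen Ω) (hx : x ∈ frontier Ω) {V : Set (EuclideanSpace ℝ (Fin n))} (hV : V ∈ 𝓝 x) :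
    ∀ᶠ u in 𝓝 (0 : EuclideanSpace ℝ (Fin n)),
      ∃ s : ℝ, x + u + s • unitGradient φ x ∈ V ∩ frontier Ω := by
  set e := unitGradient φ x with he
  have he1 : ‖e‖ = 1 := h.norm_unitGradient h.mem
  have hg := norm_pos_iff.2 (h.gradient_ne_zero x h.mem)
  have hge : inner ℝ (gradient φ x) e = ‖gradient φ x‖ := by
    rw [h.gradient_eq_smul_unitGradient h.mem, ← he, inner_smul_left, real_inner_self_eq_norm_sq,
      he1, norm_smul, he1, norm_norm]
    simp
  have h0 : φ x = 0 := h.apply_eq_zero hx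
  obtain ⟨r, hr, hball⟩ := Metric.mem_nhds_iff.1 (inter_mem hV (h.isOpen.mem_nhds h.mem))
  have e1 := eventually_pos_of_hasDerivAt (h.hasDerivAt e) (by simpa using h0) (by rwa [hge])
  have e2 := eventually_pos_of_hasDerivAt (h.hasDerivAt (-e)).neg (by simpa using h0)
    (by rwa [inner_neg_right, hge, neg_neg])
  have e3 : ∀ᶠ t in 𝓝[>] (0 : ℝ), t < r / 2 :=
    nhdsWithin_le_nhds (Iio_mem_nhds (by positivity))
  obtain ⟨t, ⟨⟨ht1, ht2⟩, ht3⟩, ht0⟩ :=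
    (((e1.and e2).and e3).and self_mem_nhdsWithin).exists
  have ht0 : 0 < t := ht0
  have hmem : ∀ u : EuclideanSpace ℝ (Fin n), ‖u‖ < r / 2 → ∀ s ∈ Icc (-t) t,
      x + u + s • e ∈ V ∩ U := by
    intro u hu s hs
    refine hball ?_
    rw [mem_ball_iff_norm]
    calc ‖x + u + s • e - x‖ = ‖u + s • e‖ := by congr 1; abel
      _ ≤ ‖u‖ + ‖s • e‖ := norm_add_le _ _
      _ = ‖u‖ + |s| := by rw [norm_smul, he1, mul_one, Real.norm_eq_abs]
      _ < r := by linarith [abs_le.2 ⟨hs.1, hs.2⟩]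
  have hcont : ∀ s ∈ Icc (-t) t, ContinuousAt (fun u => φ (x + u + s • e)) 0 := by
    intro s hs
    have h1 := (h.contDiffAt (hmem 0 (by simpa using hr) s hs).2).continuousAt
    exact ContinuousAt.comp (f := fun u => x + u + s • e) h1 (by fun_prop)
  have c1 : ∀ᶠ u in 𝓝 0, 0 < φ (x + u + t • e) :=
    (hcont t ⟨by linarith, le_rfl⟩).eventually_const_lt (by simpa using ht1)
  have c2 : ∀ᶠ u in 𝓝 0, φ (x + u + (-t) • e) < 0 :=
    (hcont (-t) ⟨le_rfl, by linarith⟩).eventually_lt_const (by simpa using ht2)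
  have c3 : ∀ᶠ u in 𝓝 (0 : EuclideanSpace ℝ (Fin n)), ‖u‖ < r / 2 := by
    filter_upwards [Metric.ball_mem_nhds (0 : EuclideanSpace ℝ (Fin n)) (half_pos hr)] with u hu
    simpa using hu
  filter_upwards [c1, c2, c3] with u hu1 hu2 hu3
  have hc : ContinuousOn (fun s : ℝ => φ (x + u + s • e)) (Icc (-t) t) := by
    intro s hs
    have h1 := (h.contDiffAt (hmem u hu3 s hs).2).continuousAt
    exact (ContinuousAt.comp (f := fun s : ℝ => x + u + s • e) h1 (by fun_prop)).continuousWithinAt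
  obtain ⟨s, hs, hs0⟩ := intermediate_value_Icc (by linarith) hc ⟨hu2.le, hu1.le⟩
  have := hmem u hu3 s hs
  exact ⟨s, this.1, (h.mem_frontier_iff hΩ this.2).2 hs0⟩

/-- Every vector orthogonal to the normal is tangent to the boundary: for small `t` the line through
`x + t v` in the normal direction meets the boundary at distance `o(t)` from `x + t v`. -/
theorem mem_tangentConeAt (h : IsLocalDefiningFunction Ω x U φ)
    (hΩ : IsOpen Ω) (hx : x ∈ frontier Ω) {v : EuclideanSpace ℝ (Fin n)}
    (hv : inner ℝ (unitGradient φ x) v = 0) : v ∈ tangentConeAt ℝ (frontier Ω) x := by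
  set e := unitGradient φ x with he
  have he1 : ‖e‖ = 1 := h.norm_unitGradient h.mem
  have key : ∀ ε : ℝ, 0 < ε → ∃ t s : ℝ, 0 < t ∧ t < ε ∧ x + (t • v + (t * s) • e) ∈ frontier Ω ∧
      |s| ≤ ε := by
    intro ε hε
    -- With `|s| ≤ η (t ‖v‖ + |s|)` and `η ≤ 1 / 2`, the height satisfies `|s| ≤ 2 η t ‖v‖ ≤ ε t`.
    set η := min (1 / 2) (ε / (2 * (‖v‖ + 1))) with hη
    have hη0 : 0 < η := lt_min (by norm_num) (by positivity)
    obtain ⟨V, hV, hV'⟩ := h.exists_abs_inner_sub_le hη0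
    have hcont : Tendsto (fun t : ℝ => t • v) (𝓝[>] 0) (𝓝 0) := by
      have : Continuous fun t : ℝ => t • v := by fun_prop
      simpa using this.continuousWithinAt (s := Ioi 0) (x := 0) |>.tendsto
    obtain ⟨t, ⟨⟨s, hsV, hsF⟩, htε⟩, ht0⟩ :=
      (((hcont.eventually (h.eventually_exists_add_smul_mem_frontier hΩ hx hV)).and
        (nhdsWithin_le_nhds (Iio_mem_nhds hε))).and self_mem_nhdsWithin).exists
    have ht0 : 0 < t := ht0
    refine ⟨t, s / t, ht0, htε, ?_, ?_⟩
    · rw [mul_div_cancel₀ _ ht0.ne', ← add_assoc]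
      exact hsF
    · have h1 := hV' _ ⟨hsV, hsF⟩ x ⟨mem_of_mem_nhds hV, hx⟩
      have h2 : x + t • v + s • unitGradient φ x - x = t • v + s • e := by
        rw [← he]; abel
      rw [h2, ← he, inner_add_right, inner_smul_right, inner_smul_right, hv,
        real_inner_self_eq_norm_sq, he1] at h1
      have h3 : ‖t • v + s • e‖ ≤ t * ‖v‖ + |s| := by
        refine (norm_add_le _ _).trans_eq ?_
        rw [norm_smul, norm_smul, he1, Real.norm_eq_abs, Real.norm_eq_abs, abs_of_pos ht0, mul_one]
      have h4 : |s| ≤ η * (t * ‖v‖ + |s|) := by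
        refine le_trans ?_ (mul_le_mul_of_nonneg_left h3 hη0.le)
        simpa using h1
      have h5 : η * |s| ≤ 1 / 2 * |s| := mul_le_mul_of_nonneg_right (min_le_left _ _) (abs_nonneg _)
      have h6 : η * (‖v‖ + 1) ≤ ε / 2 := by
        refine (mul_le_mul_of_nonneg_right (min_le_right _ _) (by positivity)).trans_eq ?_
        field_simp
      rw [abs_div, abs_of_pos ht0, div_le_iff₀ ht0]
      nlinarith [mul_le_mul_of_nonneg_left h6 ht0.le, mul_pos ht0 hη0]
  choose t s ht0 ht hF hs using fun k : ℕ => key (1 / ((k : ℝ) + 1)) (by positivity)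
  have hlim := tendsto_one_div_add_atTop_nhds_zero_nat (𝕜 := ℝ)
  have tt : Tendsto t atTop (𝓝 0) := squeeze_zero (fun k => (ht0 k).le) (fun k => (ht k).le) hlim
  have ts : Tendsto s atTop (𝓝 0) := squeeze_zero_norm hs hlim
  refine mem_tangentConeAt_of_seq atTop (fun k => (t k)⁻¹) (fun k => t k • v + (t k * s k) • e)
    ?_ (Eventually.of_forall hF) ?_
  · simpa using (tt.smul_const v).add ((tt.mul ts).smul_const e)
  · have : ∀ k, (t k)⁻¹ • (t k • v + (t k * s k) • e) = v + s k • e := by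
      intro k
      rw [smul_add, smul_smul, smul_smul, ← mul_assoc, inv_mul_cancel₀ (ht0 k).ne', one_smul,
        one_mul]
    simp only [this]
    simpa using (tendsto_const_nhds (x := v)).add (ts.smul_const e)

variable {G : Type*} [NormedAddCommGroup G] [NormedSpace ℝ G]

/-- A function that vanishes on the boundary has vanishing tangential derivatives. -/
theorem fderiv_apply_eq_zero (h : IsLocalDefiningFunction Ω x U φ)
    (hΩ : IsOpen Ω) (hx : x ∈ frontier Ω) {g : EuclideanSpace ℝ (Fin n) → G}
    {g' : EuclideanSpace ℝ (Fin n) →L[ℝ] G} (hg : HasFDerivWithinAt g g' (frontier Ω) x)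
    (h0 : ∀ᶠ y in 𝓝[frontier Ω] x, g y = 0) {v : EuclideanSpace ℝ (Fin n)}
    (hv : inner ℝ (unitGradient φ x) v = 0) : g' v = 0 := by
  have h1 : HasFDerivWithinAt g (0 : EuclideanSpace ℝ (Fin n) →L[ℝ] G) (frontier Ω) x :=
    (hasFDerivWithinAt_const (0 : G) x _).congr_of_eventuallyEq h0 (h0.self_of_nhdsWithin hx)
  simpa using hg.unique_on h1 (h.mem_tangentConeAt hΩ hx hv)

/-- A function whose tangential derivatives vanish at `x` is constant along the boundary to first
order: the normal derivative does not matter, as the boundary is tangent to the tangent space. -/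
theorem hasFDerivWithinAt_zero (h : IsLocalDefiningFunction Ω x U φ) (hx : x ∈ frontier Ω)
    {g : EuclideanSpace ℝ (Fin n) → G}
    {g' : EuclideanSpace ℝ (Fin n) →L[ℝ] G} (hg : HasFDerivWithinAt g g' (frontier Ω) x)
    (h0 : ∀ v, inner ℝ (unitGradient φ x) v = 0 → g' v = 0) :
    HasFDerivWithinAt g (0 : EuclideanSpace ℝ (Fin n) →L[ℝ] G) (frontier Ω) x := by
  set e := unitGradient φ x with he
  have he1 : ‖e‖ = 1 := h.norm_unitGradient h.mem
  have hn : HasFDerivWithinAt (fun y => inner ℝ e (y - x))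
      (0 : EuclideanSpace ℝ (Fin n) →L[ℝ] ℝ) (frontier Ω) x := by
    rw [hasFDerivWithinAt_iff_isLittleO, Asymptotics.isLittleO_iff]
    intro c hc
    obtain ⟨V, hV, hV'⟩ := h.exists_abs_inner_sub_le hc
    filter_upwards [inter_mem_nhdsWithin (frontier Ω) hV] with y hy
    simpa using hV' y hy.symm x ⟨mem_of_mem_nhds hV, hx⟩
  have hlin : ∀ w, g' w = inner ℝ e w • g' e := by
    intro w
    have := h0 (w - inner ℝ e w • e) (by
      rw [inner_sub_right, inner_smul_right, real_inner_self_eq_norm_sq, he1]; ring)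
    rwa [map_sub, map_smul, sub_eq_zero] at this
  -- So `g'` is the derivative of a multiple of `⟪e, y - x⟫`, which is `o(‖y - x‖)` on the boundary.
  have h2 : HasFDerivAt (fun y => inner ℝ e (y - x) • g' e) g' x := by
    have h3 : HasFDerivAt (fun y => g' (y - x)) g' x := by
      exact g'.hasFDerivAt.comp x ((hasFDerivAt_id x).sub_const x)
    exact h3.congr_of_eventuallyEq (Eventually.of_forall fun y => (hlin _).symm)
  refine (((hg.sub h2.hasFDerivWithinAt).add (hn.smul_const (g' e))).congr_fderiv ?_).congr
    (fun y _ => ?_) ?_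
  · ext; simp
  · simp
  · simp

end IsLocalDefiningFunction

end SmoothDomain

/-! ### The arithmetic-geometric mean inequality for symmetric operators -/

namespace LinearMap.IsSymmetric

variable {V : Type*} [NormedAddCommGroup V] [InnerProductSpace ℝ V] [FiniteDimensional ℝ V]
  {T : V →ₗ[ℝ] V} {d : ℕ}

theorem eigenvalues_nonneg (hT : T.IsSymmetric) (hd : Module.finrank ℝ V = d)
    (hnn : ∀ v, 0 ≤ inner ℝ v (T v)) (i : Fin d) : 0 ≤ hT.eigenvalues hd i :=
  eigenvalue_nonneg_of_nonneg (hT.hasEigenvalue_eigenvalues hd i) hnn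

theorem prod_rpow_eigenvalues (hT : T.IsSymmetric) (hd : Module.finrank ℝ V = d) (hd0 : d ≠ 0)
    (hnn : ∀ v, 0 ≤ inner ℝ v (T v)) :
    (∏ i, hT.eigenvalues hd i ^ (d : ℝ)⁻¹) ^ d = LinearMap.det T := by
  rw [← Finset.prod_pow, hT.det_eq_prod_eigenvalues hd]
  exact Finset.prod_congr rfl fun i _ =>
    Real.rpow_inv_natCast_pow (hT.eigenvalues_nonneg hd hnn i) hd0

theorem sum_inv_mul_eigenvalues (hT : T.IsSymmetric) (hd : Module.finrank ℝ V = d) :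
    ∑ i, (d : ℝ)⁻¹ * hT.eigenvalues hd i = LinearMap.trace ℝ V T / d := by
  rw [hT.trace_eq_sum_eigenvalues hd, ← Finset.mul_sum, div_eq_inv_mul]
  rfl

theorem det_nonneg (hT : T.IsSymmetric) (hnn : ∀ v, 0 ≤ inner ℝ v (T v)) :
    0 ≤ LinearMap.det T := by
  rw [hT.det_eq_prod_eigenvalues rfl]
  exact Finset.prod_nonneg fun i _ => hT.eigenvalues_nonneg rfl hnn i

theorem det_le_trace_div_pow (hT : T.IsSymmetric) (hd : Module.finrank ℝ V = d) (hd0 : d ≠ 0)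
    (hnn : ∀ v, 0 ≤ inner ℝ v (T v)) :
    LinearMap.det T ≤ (LinearMap.trace ℝ V T / d) ^ d := by
  rw [← hT.prod_rpow_eigenvalues hd hd0 hnn, ← hT.sum_inv_mul_eigenvalues hd]
  have h0 := hT.eigenvalues_nonneg hd hnn
  refine pow_le_pow_left₀ (Finset.prod_nonneg fun i _ => Real.rpow_nonneg (h0 i) _) ?_ d
  exact Real.geom_mean_le_arith_mean_weighted _ _ _ (fun i _ => by positivity)
    (by simp [hd0]) fun i _ => h0 i

/-- In the equality case of the arithmetic-geometric mean inequality the operator is a multiple of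
the identity. -/
theorem apply_eq_smul_of_det_eq (hT : T.IsSymmetric) (hd : Module.finrank ℝ V = d) (hd0 : d ≠ 0)
    (hnn : ∀ v, 0 ≤ inner ℝ v (T v))
    (heq : LinearMap.det T = (LinearMap.trace ℝ V T / d) ^ d) (v : V) :
    T v = (LinearMap.trace ℝ V T / d) • v := by
  have h0 := hT.eigenvalues_nonneg hd hnn
  rw [← hT.prod_rpow_eigenvalues hd hd0 hnn, ← hT.sum_inv_mul_eigenvalues hd] at heq
  have h1 := (pow_left_inj₀ (Finset.prod_nonneg fun i _ => Real.rpow_nonneg (h0 i) _)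
    (Finset.sum_nonneg fun i _ => mul_nonneg (by positivity) (h0 i)) hd0).1 heq
  rw [Real.geom_mean_eq_arith_mean_weighted_iff_of_pos' _ _ _ (fun i _ => by positivity)
    (by simp [hd0]) fun i _ => h0 i, hT.sum_inv_mul_eigenvalues hd] at h1
  have h2 : T = (LinearMap.trace ℝ V T / d) • LinearMap.id := by
    refine (hT.eigenvectorBasis hd).toBasis.ext fun i => ?_
    rw [OrthonormalBasis.coe_toBasis, hT.apply_eigenvectorBasis, h1 i (Finset.mem_univ i)]
    rfl
  conv_lhs => rw [h2]
  rfl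

end LinearMap.IsSymmetric

namespace SmoothDomain

variable {n : ℕ} {Ω U : Set (EuclideanSpace ℝ (Fin n))} {x y : EuclideanSpace ℝ (Fin n)}
  {φ : EuclideanSpace ℝ (Fin n) → ℝ}

/-! ### The Weingarten map -/

/-- The derivative of the unit normal field `N = unitGradient φ` precomposed with the orthogonal
projection `v ↦ v - ⟪N, v⟫ N`. At a boundary point it extends the Weingarten map by zero on the
normal line, and it depends smoothly on the point. -/
noncomputable def shapeOperator (φ : EuclideanSpace ℝ (Fin n) → ℝ)
    (y : EuclideanSpace ℝ (Fin n)) : EuclideanSpace ℝ (Fin n) →L[ℝ] EuclideanSpace ℝ (Fin n) :=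
  fderiv ℝ (unitGradient φ) y ∘L (ContinuousLinearMap.id ℝ _ -
    (innerSL ℝ (unitGradient φ y)).smulRight (unitGradient φ y))

theorem shapeOperator_apply (v : EuclideanSpace ℝ (Fin n)) :
    shapeOperator φ y v = fderiv ℝ (unitGradient φ) y
      (v - inner ℝ (unitGradient φ y) v • unitGradient φ y) := by
  simp [shapeOperator]

/-- The trace as a continuous linear functional. -/
noncomputable def traceCLM (n : ℕ) :
    (EuclideanSpace ℝ (Fin n) →L[ℝ] EuclideanSpace ℝ (Fin n)) →L[ℝ] ℝ :=
  LinearMap.toContinuousLinearMap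
    (LinearMap.trace ℝ (EuclideanSpace ℝ (Fin n)) ∘ₗ ContinuousLinearMap.coeLM ℝ)

theorem traceCLM_apply (A : EuclideanSpace ℝ (Fin n) →L[ℝ] EuclideanSpace ℝ (Fin n)) :
    traceCLM n A = LinearMap.trace ℝ _ A.toLinearMap := rfl

namespace IsLocalDefiningFunction

theorem contDiffAt_shapeOperator (h : IsLocalDefiningFunction Ω x U φ) (hy : y ∈ U) :
    ContDiffAt ℝ ∞ (shapeOperator φ) y := by
  have h1 := h.contDiffAt_unitGradient hy
  have h2 : ContDiffAt ℝ ∞ (fderiv ℝ (unitGradient φ)) y := h1.fderiv_right (by simp)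
  have h3 : ContDiffAt ℝ ∞ (fun z => innerSL ℝ (unitGradient φ z)) y :=
    (innerSL ℝ).contDiff.contDiffAt.comp y h1
  exact h2.clm_comp (contDiffAt_const.sub (h3.smulRight h1))

theorem hasFDerivWithinAt_outerNormal (h : IsLocalDefiningFunction Ω x U φ)
    (hx : x ∈ frontier Ω) :
    HasFDerivWithinAt (outerNormal Ω) (fderiv ℝ (unitGradient φ) x) (frontier Ω) x := by
  refine (h.hasFDerivAt_unitGradient h.mem).hasFDerivWithinAt.congr_of_eventuallyEq ?_
    (h.outerNormal_eq hx)
  filter_upwards [inter_mem_nhdsWithin (frontier Ω) (h.isOpen.mem_nhds h.mem)] with y hy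
  exact (h.center hy.2).outerNormal_eq hy.1

theorem coe_weingartenMap (h : IsLocalDefiningFunction Ω x U φ) (hΩ : IsOpen Ω)
    (hx : x ∈ frontier Ω) (v : tangentSpace Ω x) :
    (weingartenMap Ω x v : EuclideanSpace ℝ (Fin n)) = fderiv ℝ (unitGradient φ) x v := by
  have h1 := h.hasFDerivWithinAt_outerNormal hx
  have h2 : fderivWithin ℝ (outerNormal Ω) (frontier Ω) x v = fderiv ℝ (unitGradient φ) x v :=
    h1.differentiableWithinAt.hasFDerivWithinAt.unique_on h1
      (h.mem_tangentConeAt hΩ hx ((h.mem_tangentSpace_iff hx).1 v.2))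
  have h3 : fderiv ℝ (unitGradient φ) x v ∈ tangentSpace Ω x :=
    (h.mem_tangentSpace_iff hx).2 (h.inner_fderiv_unitGradient h.mem v)
  rw [weingartenMap]
  simp only [ContinuousLinearMap.comp_apply, Submodule.subtypeL_apply, h2]
  exact Submodule.starProjection_eq_self_iff.2 h3

theorem meanCurvature_eq (h : IsLocalDefiningFunction Ω x U φ) (hΩ : IsOpen Ω)
    (hx : x ∈ frontier Ω) : meanCurvature Ω x = traceCLM n (shapeOperator φ x) := by
  have hS : ∀ v, shapeOperator φ x v ∈ tangentSpace Ω x := fun v => by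
    rw [shapeOperator_apply]
    exact (h.mem_tangentSpace_iff hx).2 (h.inner_fderiv_unitGradient h.mem _)
  have h1 := LinearMap.trace_comp_comm' (R := ℝ) (tangentSpace Ω x).subtype
    ((shapeOperator φ x).toLinearMap.codRestrict (tangentSpace Ω x) hS)
  rw [traceCLM_apply, meanCurvature]
  convert h1 using 2
  · ext v : 2
    rw [ContinuousLinearMap.coe_coe, h.coe_weingartenMap hΩ hx]
    have hv := (h.mem_tangentSpace_iff hx).1 v.2
    simp [shapeOperator_apply, hv]
  · rfl

theorem weingartenMap_isSymmetric (h : IsLocalDefiningFunction Ω x U φ) (hΩ : IsOpen Ω)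
    (hx : x ∈ frontier Ω) : (weingartenMap Ω x).toLinearMap.IsSymmetric := by
  intro u v
  simp only [Submodule.coe_inner, ContinuousLinearMap.coe_coe, h.coe_weingartenMap hΩ hx]
  rw [h.inner_fderiv_unitGradient_comm h.mem ((h.mem_tangentSpace_iff hx).1 u.2)
    ((h.mem_tangentSpace_iff hx).1 v.2), real_inner_comm]

theorem finrank_tangentSpace (h : IsLocalDefiningFunction Ω x U φ) (hx : x ∈ frontier Ω) :
    Module.finrank ℝ (tangentSpace Ω x) = n - 1 := by
  have h0 : outerNormal Ω x ≠ 0 := by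
    rw [← norm_ne_zero_iff, h.outerNormal_eq hx, h.norm_unitGradient h.mem]
    exact one_ne_zero
  have h1 := Submodule.finrank_add_finrank_orthogonal (ℝ ∙ outerNormal Ω x)
  rw [finrank_span_singleton h0, finrank_euclideanSpace_fin] at h1
  unfold tangentSpace
  omega

/-! ### Convex domains -/

/-- The boundary hyperplane at `x` supports the convex domain. -/
theorem inner_unitGradient_sub_nonpos (h : IsLocalDefiningFunction Ω x U φ) (hΩ : IsOpen Ω)
    (hconv : Convex ℝ Ω) (hx : x ∈ frontier Ω) (hy : y ∈ closure Ω) :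
    inner ℝ (unitGradient φ x) (y - x) ≤ 0 := by
  refine closure_minimal (t := {y | inner ℝ (unitGradient φ x) (y - x) ≤ 0}) (fun y hy => ?_)
    (isClosed_le (by fun_prop) continuous_const) hy
  show inner ℝ (unitGradient φ x) (y - x) ≤ 0
  by_contra! hpos
  have hpos' : 0 < inner ℝ (gradient φ x) (y - x) := by
    rw [h.gradient_eq_smul_unitGradient h.mem, inner_smul_left]
    exact mul_pos (norm_pos_iff.2 (h.gradient_ne_zero x h.mem)) hpos
  have hcont : Tendsto (fun t : ℝ => x + t • (y - x)) (𝓝[>] 0) (𝓝 x) := by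
    have : Continuous fun t : ℝ => x + t • (y - x) := by fun_prop
    simpa using this.continuousWithinAt (s := Ioi 0) (x := 0) |>.tendsto
  have e1 := eventually_pos_of_hasDerivAt (h.hasDerivAt (y - x))
    (by simpa using h.apply_eq_zero hx) hpos'
  obtain ⟨t, ⟨⟨ht, htU⟩, ht1⟩, ht0⟩ := (((e1.and (hcont (h.isOpen.mem_nhds h.mem))).and
    (nhdsWithin_le_nhds (Iic_mem_nhds one_pos))).and self_mem_nhdsWithin).exists
  have h1 : x + t • (y - x) ∈ interior Ω :=
    hconv.add_smul_sub_mem_interior' (frontier_subset_closure hx) (by rwa [hΩ.interior_eq])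
      ⟨ht0, ht1⟩
  rw [hΩ.interior_eq] at h1
  have h2 : x + t • (y - x) ∈ {y ∈ U | φ y < 0} := h.inter_eq ▸ ⟨h1, htU⟩
  exact absurd h2.2 (not_lt.2 ht.le)

/-- The Weingarten map of a convex domain is positive semidefinite, since the Gauss map is
monotone. -/
theorem inner_weingartenMap_nonneg (h : IsLocalDefiningFunction Ω x U φ) (hΩ : IsOpen Ω)
    (hconv : Convex ℝ Ω) (hx : x ∈ frontier Ω) (v : tangentSpace Ω x) :
    0 ≤ inner ℝ v (weingartenMap Ω x v) := by
  rw [Submodule.coe_inner, h.coe_weingartenMap hΩ hx]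
  have hD := (h.hasFDerivAt_unitGradient h.mem).hasFDerivWithinAt (s := frontier Ω)
  obtain ⟨α, l, hl, c, d, hd, hF, hcd⟩ := exists_fun_of_mem_tangentConeAt
    (h.mem_tangentConeAt hΩ hx ((h.mem_tangentSpace_iff hx).1 v.2))
  refine ge_of_tendsto (hcd.inner (hD.lim hd hF hcd)) ?_
  have hlim : Tendsto (fun k => x + d k) l (𝓝 x) := by simpa using tendsto_const_nhds.add hd
  filter_upwards [hF, hlim (h.isOpen.mem_nhds h.mem)] with k hk hkU
  have h1 := h.inner_unitGradient_sub_nonpos hΩ hconv hx (frontier_subset_closure hk)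
  have h2 := (h.center hkU).inner_unitGradient_sub_nonpos hΩ hconv hk (frontier_subset_closure hx)
  rw [add_sub_cancel_left] at h1
  rw [sub_add_cancel_left, inner_neg_right] at h2
  rw [inner_smul_left, inner_smul_right, inner_sub_right, real_inner_comm, real_inner_comm _ (d k)]
  simp only [conj_trivial]
  nlinarith [mul_self_nonneg (c k)]

end IsLocalDefiningFunction

end SmoothDomain

/-! ### Euclidean Hausdorff measure and Lipschitz maps -/

section Lipschitz

variable {X Y : Type*} [EMetricSpace X] [MeasurableSpace X] [BorelSpace X]
  [EMetricSpace Y] [MeasurableSpace Y] [BorelSpace Y] {f : X → Y} {s : Set X} {κ : ℝ≥0}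

theorem LipschitzOnWith.euclideanHausdorffMeasure_image_le (hf : LipschitzOnWith κ f s) (d : ℕ) :
    μHE[d] (f '' s) ≤ (κ : ENNReal) ^ d * μHE[d] s := by
  have h := hf.hausdorffMeasure_image_le (d := d) (by positivity)
  rw [ENNReal.rpow_natCast] at h
  simp only [Measure.euclideanHausdorffMeasure_def, Measure.smul_apply, ENNReal.smul_def,
    smul_eq_mul]
  rw [mul_left_comm]
  gcongr

theorem euclideanHausdorffMeasure_le_of_edist_le
    (hf : ∀ y ∈ s, ∀ z ∈ s, edist y z ≤ κ * edist (f y) (f z)) (d : ℕ) :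
    μHE[d] s ≤ (κ : ENNReal) ^ d * μHE[d] (f '' s) := by
  rcases s.eq_empty_or_nonempty with rfl | ⟨x₀, -⟩
  · simp
  have : Nonempty X := ⟨x₀⟩
  have hinj : InjOn f s := fun y hy z hz hyz => by
    have := hf y hy z hz
    rw [hyz, edist_self, mul_zero] at this
    exact edist_eq_zero.1 (le_antisymm this zero_le)
  have hg : ∀ y ∈ s, Function.invFunOn f s (f y) = y := fun y hy => hinj.leftInvOn_invFunOn hy
  have hlip : LipschitzOnWith κ (Function.invFunOn f s) (f '' s) := by
    rintro _ ⟨y, hy, rfl⟩ _ ⟨z, hz, rfl⟩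
    rw [hg y hy, hg z hz]
    exact hf y hy z hz
  have himg : Function.invFunOn f s '' (f '' s) = s := by
    rw [image_image]
    exact (image_congr hg).trans (image_id' s)
  have := hlip.euclideanHausdorffMeasure_image_le d
  rwa [himg] at this

end Lipschitz

section Hyperplane

variable {V : Type*} [NormedAddCommGroup V] [InnerProductSpace ℝ V]

theorem coe_orthogonalProjectionOnto_orthogonal_singleton {e : V} (he : ‖e‖ = 1) (v : V) :
    ((ℝ ∙ e)ᗮ.orthogonalProjectionOnto v : V) = v - inner ℝ e v • e := by
  rw [Submodule.orthogonalProjectionOnto_orthogonal, ← Submodule.starProjection_unit_singleton ℝ he]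

/-- A set whose secants are almost orthogonal to `e` is mapped to the hyperplane orthogonal to `e`
with little contraction. -/
theorem norm_le_mul_norm_orthogonalProjectionOnto {e : V} (he : ‖e‖ = 1) {κ : ℝ} (hκ : 0 < κ)
    {v : V} (hv : |inner ℝ e v| ≤ (1 - κ⁻¹) * ‖v‖) :
    ‖v‖ ≤ κ * ‖(ℝ ∙ e)ᗮ.orthogonalProjectionOnto v‖ := by
  have h1 : ‖v‖ ≤ ‖(ℝ ∙ e)ᗮ.orthogonalProjectionOnto v‖ + |inner ℝ e v| := by
    have h0 : ‖(ℝ ∙ e)ᗮ.orthogonalProjectionOnto v‖ = ‖v - inner ℝ e v • e‖ := by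
      rw [← coe_orthogonalProjectionOnto_orthogonal_singleton he]
      rfl
    rw [h0]
    calc ‖v‖ = ‖v - inner ℝ e v • e + inner ℝ e v • e‖ := by rw [sub_add_cancel]
      _ ≤ _ := norm_add_le _ _
      _ = _ := by rw [norm_smul (inner ℝ e v) e, he, mul_one, Real.norm_eq_abs]
  have h2 : κ⁻¹ * ‖v‖ ≤ ‖(ℝ ∙ e)ᗮ.orthogonalProjectionOnto v‖ := by linarith
  rwa [inv_mul_le_iff₀ hκ] at h2

/-- The secants of the unit sphere near `e` are almost orthogonal to `e`. -/
theorem abs_inner_sub_le_of_norm_eq_one {e p q : V} {η : ℝ} (hp : ‖p‖ = 1) (hq : ‖q‖ = 1)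
    (hpe : ‖p - e‖ ≤ η) (hqe : ‖q - e‖ ≤ η) : |inner ℝ e (p - q)| ≤ η * ‖p - q‖ := by
  have h1 : inner ℝ (p + q) (p - q) = (0 : ℝ) := by
    rw [inner_add_left, inner_sub_right, inner_sub_right, real_inner_self_eq_norm_sq,
      real_inner_self_eq_norm_sq, hp, hq, real_inner_comm]
    ring
  have h2 : inner ℝ e (p - q) = -(1 / 2) * inner ℝ ((p - e) + (q - e)) (p - q) := by
    have h3 : (p - e) + (q - e) = (p + q) - (2 : ℝ) • e := by rw [two_smul]; abel
    rw [h3, inner_sub_left, h1, inner_smul_left]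
    simp
  have h4 := abs_real_inner_le_norm ((p - e) + (q - e)) (p - q)
  have h5 : ‖(p - e) + (q - e)‖ ≤ 2 * η := (norm_add_le _ _).trans (by linarith)
  rw [h2, abs_mul, abs_neg, abs_of_pos (by norm_num : (0 : ℝ) < 1 / 2)]
  nlinarith [norm_nonneg (p - q), mul_le_mul_of_nonneg_right h5 (norm_nonneg (p - q))]

variable [MeasurableSpace V] [BorelSpace V]

theorem euclideanHausdorffMeasure_le_image_orthogonalProjectionOnto {e : V} (he : ‖e‖ = 1)
    {κ : ℝ≥0} (hκ : 0 < κ) {s : Set V}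
    (hs : ∀ y ∈ s, ∀ z ∈ s, |inner ℝ e (y - z)| ≤ (1 - (κ : ℝ)⁻¹) * ‖y - z‖) (d : ℕ) :
    μHE[d] s ≤ (κ : ENNReal) ^ d * μHE[d] ((ℝ ∙ e)ᗮ.orthogonalProjectionOnto '' s) := by
  refine euclideanHausdorffMeasure_le_of_edist_le (fun y hy z hz => ?_) d
  have h := norm_le_mul_norm_orthogonalProjectionOnto he (NNReal.coe_pos.2 hκ) (hs y hy z hz)
  rw [map_sub, ← dist_eq_norm, ← dist_eq_norm] at h
  rw [edist_nndist, edist_nndist]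
  exact_mod_cast h

theorem euclideanHausdorffMeasure_image_orthogonalProjectionOnto_le (K : Submodule ℝ V)
    [K.HasOrthogonalProjection] (s : Set V) (d : ℕ) :
    μHE[d] (K.orthogonalProjectionOnto '' s) ≤ μHE[d] s := by
  simpa using (K.lipschitzWith_orthogonalProjectionOnto.lipschitzOnWith
    (s := s)).euclideanHausdorffMeasure_image_le d

end Hyperplane

/-! ### From local to global area estimates -/

/-- If a map increases the measure of sets near each point `x` of a compact set by at most a factor
arbitrarily close to `g x`, with `g` continuous, then the measure of the image of any measurable
subset is at most the integral of `g` over it. -/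
theorem measure_image_le_setLIntegral {X Y : Type*} [TopologicalSpace X] [MeasurableSpace X]
    [OpensMeasurableSpace X] [MeasurableSpace Y] {σ : Measure X} {τ : Measure Y} {f : X → Y}
    {K B : Set X} {g : X → ℝ} (hK : IsCompact K) (hσ : σ K ≠ ⊤) (hg : ContinuousOn g K)
    (hloc : ∀ x ∈ K, ∀ m : ℝ≥0, ENNReal.ofReal (g x) < m →
      ∃ V ∈ 𝓝 x, ∀ A ⊆ V ∩ K, τ (f '' A) ≤ m * σ A)
    (hBK : B ⊆ K) (hB : MeasurableSet B) :
    τ (f '' B) ≤ ∫⁻ x in B, ENNReal.ofReal (g x) ∂σ := by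
  have key : ∀ ε : ℝ≥0, 0 < ε →
      τ (f '' B) ≤ ∫⁻ x in B, (ENNReal.ofReal (g x) + (2 * ε : ℝ≥0)) ∂σ := by
    intro ε hε
    -- The estimate is inherited by unions once the pieces can be enlarged to measurable sets.
    have hind : ∃ S, K ⊆ S ∧ MeasurableSet S ∧ ∀ A ⊆ S ∩ K, MeasurableSet A →
        τ (f '' A) ≤ ∫⁻ x in A, (ENNReal.ofReal (g x) + (2 * ε : ℝ≥0)) ∂σ := by
      refine hK.induction_on
        (p := fun s => ∃ S, s ⊆ S ∧ MeasurableSet S ∧ ∀ A ⊆ S ∩ K, MeasurableSet A →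
          τ (f '' A) ≤ ∫⁻ x in A, (ENNReal.ofReal (g x) + (2 * ε : ℝ≥0)) ∂σ) ?_ ?_ ?_ ?_
      · refine ⟨∅, le_rfl, MeasurableSet.empty, fun A hA _ => ?_⟩
        rw [empty_inter, subset_empty_iff] at hA
        simp [hA]
      · rintro s t hst ⟨S, hS⟩
        exact ⟨S, hst.trans hS.1, hS.2⟩
      · rintro s t ⟨S, hsS, hS, hS'⟩ ⟨T, htT, hT, hT'⟩
        refine ⟨S ∪ T, union_subset_union hsS htT, hS.union hT, fun A hA hAm => ?_⟩
        rw [← inter_union_sdiff A S, image_union,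
          lintegral_union (hAm.diff hS) disjoint_sdiff_inter.symm]
        refine (measure_union_le _ _).trans (add_le_add ?_ ?_)
        · exact hS' _ (fun a ha => ⟨ha.2, (hA ha.1).2⟩) (hAm.inter hS)
        · exact hT' _ (fun a ha => ⟨(hA ha.1).1.resolve_left ha.2, (hA ha.1).2⟩) (hAm.diff hS)
      · intro x hx
        obtain ⟨V, hV, hV'⟩ := hloc x hx ((g x).toNNReal + ε) (by
          rw [ENNReal.coe_add]
          exact ENNReal.lt_add_right ENNReal.coe_ne_top (by simpa using hε.ne'))
        have h1 : ∀ᶠ y in 𝓝[K] x, g x - ε < g y :=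
          (hg x hx).eventually_const_lt (by
            have : (0 : ℝ) < ε := hε
            linarith)
        obtain ⟨W, hW, hWg⟩ := mem_nhdsWithin_iff_exists_mem_nhds_inter.1 h1
        obtain ⟨O, hO, hOo, hxO⟩ := mem_nhds_iff.1 (inter_mem hV hW)
        refine ⟨O, mem_nhdsWithin_of_mem_nhds (hOo.mem_nhds hxO), O, le_rfl, hOo.measurableSet,
          fun A hA hAm => ?_⟩
        refine (hV' A fun a ha => ⟨(hO (hA ha).1).1, (hA ha).2⟩).trans ?_
        rw [← setLIntegral_const]
        refine setLIntegral_mono' hAm fun y hy => ?_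
        have h2 : g x - ε < g y := hWg ⟨(hO (hA hy).1).2, (hA hy).2⟩
        have h3 : (g x).toNNReal ≤ (g y).toNNReal + ε := by
          rw [Real.toNNReal_le_iff_le_coe, NNReal.coe_add]
          linarith [Real.le_coe_toNNReal (g y)]
        have h4 : (g x).toNNReal + ε ≤ (g y).toNNReal + 2 * ε := by
          rw [two_mul, ← add_assoc]
          gcongr
        rw [ENNReal.ofReal]
        exact_mod_cast h4
    obtain ⟨S, hKS, -, hS⟩ := hind
    exact hS B (fun b hb => ⟨hKS (hBK hb), hBK hb⟩) hB
  have hσB : σ B ≠ ⊤ := ((measure_mono hBK).trans_lt hσ.lt_top).ne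
  have hlim : Tendsto (fun ε : ℝ≥0 => ∫⁻ x in B, ENNReal.ofReal (g x) ∂σ +
      ((2 * ε : ℝ≥0) : ENNReal) * σ B) (𝓝[>] 0) (𝓝 (∫⁻ x in B, ENNReal.ofReal (g x) ∂σ)) := by
    have h1 : Tendsto (fun ε : ℝ≥0 => ((2 * ε : ℝ≥0) : ENNReal)) (𝓝[>] 0) (𝓝 0) := by
      have : Continuous fun ε : ℝ≥0 => ((2 * ε : ℝ≥0) : ENNReal) := by fun_prop
      simpa using (this.tendsto 0).mono_left nhdsWithin_le_nhds
    simpa using (tendsto_const_nhds (x := ∫⁻ x in B, ENNReal.ofReal (g x) ∂σ)).add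
      (ENNReal.Tendsto.mul_const h1 (Or.inr hσB))
  refine ge_of_tendsto hlim ?_
  filter_upwards [self_mem_nhdsWithin] with ε hε
  refine (key ε hε).trans_eq ?_
  rw [lintegral_add_right _ measurable_const, setLIntegral_const]

namespace SmoothDomain

variable {n : ℕ} {Ω U : Set (EuclideanSpace ℝ (Fin n))} {x y : EuclideanSpace ℝ (Fin n)}
  {φ : EuclideanSpace ℝ (Fin n) → ℝ}

/-! ### Surface measure and the Gauss map near a point -/

namespace IsLocalDefiningFunction

theorem norm_outerNormal (h : IsLocalDefiningFunction Ω x U φ) (hx : x ∈ frontier Ω) :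
    ‖outerNormal Ω x‖ = 1 := by
  rw [h.outerNormal_eq hx, h.norm_unitGradient h.mem]

theorem euclideanHausdorffMeasure_tangentSpace (h : IsLocalDefiningFunction Ω x U φ)
    (hx : x ∈ frontier Ω) : (μHE[n - 1] : Measure (tangentSpace Ω x)) = volume := by
  rw [← h.finrank_tangentSpace hx]
  exact InnerProductSpace.euclideanHausdorffMeasure_eq_volume

theorem exists_measure_inter_frontier_lt_top (h : IsLocalDefiningFunction Ω x U φ)
    (hx : x ∈ frontier Ω) : ∃ V ∈ 𝓝 x, μHE[n - 1] (V ∩ frontier Ω) < ⊤ := by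
  obtain ⟨V, hV, hV'⟩ := h.exists_abs_inner_sub_le (η := 1 - ((2 : ℝ≥0) : ℝ)⁻¹) (by norm_num)
  refine ⟨V ∩ Metric.ball x 1, inter_mem hV (Metric.ball_mem_nhds x one_pos), ?_⟩
  rw [← h.outerNormal_eq hx] at hV'
  refine (euclideanHausdorffMeasure_le_image_orthogonalProjectionOnto (h.norm_outerNormal hx)
    (κ := 2) two_pos (fun y hy z hz => hV' y ⟨hy.1.1, hy.2⟩ z ⟨hz.1.1, hz.2⟩) _).trans_lt ?_
  refine ENNReal.mul_lt_top (by simp) ?_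
  change μHE[n - 1] ((tangentSpace Ω x).orthogonalProjectionOnto '' _) < ⊤
  rw [h.euclideanHausdorffMeasure_tangentSpace hx]
  refine Bornology.IsBounded.measure_lt_top ?_
  exact (tangentSpace Ω x).lipschitzWith_orthogonalProjectionOnto.isBounded_image
    (Metric.isBounded_ball.subset fun y hy => hy.1.2)

/-- Boundary pieces have positive area, since their projection to the tangent space contains an open
set and the projection does not increase areas. -/
theorem measure_inter_frontier_pos (h : IsLocalDefiningFunction Ω x U φ) (hΩ : IsOpen Ω)
    (hx : x ∈ frontier Ω) {V : Set (EuclideanSpace ℝ (Fin n))} (hV : V ∈ 𝓝 x) :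
    0 < μHE[n - 1] (V ∩ frontier Ω) := by
  refine lt_of_lt_of_le ?_ (euclideanHausdorffMeasure_image_orthogonalProjectionOnto_le
    (tangentSpace Ω x) (V ∩ frontier Ω) (n - 1))
  rw [h.euclideanHausdorffMeasure_tangentSpace hx]
  refine Measure.measure_pos_of_mem_nhds volume
    (x := (tangentSpace Ω x).orthogonalProjectionOnto x) ?_
  have hcont : Tendsto (fun w : tangentSpace Ω x =>
      ((w - (tangentSpace Ω x).orthogonalProjectionOnto x : tangentSpace Ω x) :
        EuclideanSpace ℝ (Fin n))) (𝓝 ((tangentSpace Ω x).orthogonalProjectionOnto x)) (𝓝 0) := by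
    have : Continuous fun w : tangentSpace Ω x =>
      ((w - (tangentSpace Ω x).orthogonalProjectionOnto x : tangentSpace Ω x) :
        EuclideanSpace ℝ (Fin n)) := by fun_prop
    simpa using this.tendsto ((tangentSpace Ω x).orthogonalProjectionOnto x)
  filter_upwards [hcont.eventually (h.eventually_exists_add_smul_mem_frontier hΩ hx hV)] with w hw
  obtain ⟨s, hs⟩ := hw
  refine ⟨_, hs, ?_⟩
  rw [map_add, map_add, map_smul, Submodule.orthogonalProjectionOnto_mem_subspace_eq_self,
    ← h.outerNormal_eq hx,
    Submodule.orthogonalProjectionOnto_orthogonalComplement_singleton_eq_zero]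
  simp

/-- Near `x` the Gauss map increases the area by at most a factor close to the determinant of the
Weingarten map. Projecting the boundary near `x` and the sphere near the normal at `x` to their
common tangent space changes areas by factors close to one and turns the Gauss map into a map that
is approximated by the Weingarten map. -/
theorem exists_measure_image_outerNormal_le (h : IsLocalDefiningFunction Ω x U φ) (hΩ : IsOpen Ω)
    (hx : x ∈ frontier Ω) {m : ℝ≥0} (hm : ENNReal.ofReal |(weingartenMap Ω x).det| < m) :
    ∃ V ∈ 𝓝 x, ∀ A ⊆ V ∩ frontier Ω,
      μHE[n - 1] (outerNormal Ω '' A) ≤ m * μHE[n - 1] A := by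
  obtain ⟨m', hm', hm'm⟩ := ENNReal.lt_iff_exists_nnreal_btwn.1 hm
  rw [ENNReal.coe_lt_coe] at hm'm
  obtain ⟨κ, ⟨hκm, hκ2⟩, hκ1⟩ : ∃ κ : ℝ≥0, (κ ^ (n - 1) * m' < m ∧ κ < 2) ∧ 1 < κ := by
    have h1 : ∀ᶠ κ : ℝ≥0 in 𝓝 1, κ ^ (n - 1) * m' < m := by
      have : Continuous fun κ : ℝ≥0 => κ ^ (n - 1) * m' := by fun_prop
      exact this.continuousAt.eventually_lt_const (by simpa using hm'm)
    have h2 : ∀ᶠ κ : ℝ≥0 in 𝓝 1, κ < 2 := Iio_mem_nhds one_lt_two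
    exact (((h1.and h2).filter_mono (nhdsWithin_le_nhds (s := Ioi 1))).and
      self_mem_nhdsWithin).exists
  have hκ0 : 0 < κ := one_pos.trans hκ1
  have hκη : (0 : ℝ) < 1 - (κ : ℝ)⁻¹ := sub_pos.2 (inv_lt_one_of_one_lt₀ hκ1)
  obtain ⟨δ, hδ, hδ0⟩ := ((addHaar_image_le_mul_of_det_lt
    (volume : Measure (tangentSpace Ω x)) (weingartenMap Ω x) hm').and self_mem_nhdsWithin).exists
  have hδ0 : 0 < δ := hδ0
  have hδ0' : (0 : ℝ) < δ := hδ0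
  have hcoeW := h.coe_weingartenMap hΩ hx
  have hTmem := fun v => (h.mem_tangentSpace_iff hx (v := v)).2
  have hDT := h.inner_fderiv_unitGradient h.mem
  have heq := h.outerNormal_eq hx
  set e := outerNormal Ω x with he
  have he1 : ‖e‖ = 1 := h.norm_outerNormal hx
  set D := fderiv ℝ (unitGradient φ) x with hD
  -- The projection contracts the boundary near `x` by at most the factor `κ`, and the normal part
  -- of a secant contributes at most `δ / 4` times its length to the linearization error.
  set η := min (1 - (κ : ℝ)⁻¹) (δ / (4 * (‖D‖ + 1))) with hη
  have hη0 : 0 < η := lt_min hκη (by positivity)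
  obtain ⟨V₁, hV₁, hflat⟩ := h.exists_abs_inner_sub_le hη0
  obtain ⟨V₂, hV₂, happ⟩ := ((h.contDiffAt_unitGradient h.mem).hasStrictFDerivAt
    (by simp)).approximates_deriv_on_nhds (c := δ / 4) (Or.inr (by positivity))
  have hV₃ : ∀ᶠ y in 𝓝 x, ‖unitGradient φ y - e‖ < 1 - (κ : ℝ)⁻¹ := by
    have : ContinuousAt (fun y => ‖unitGradient φ y - e‖) x :=
      ((h.contDiffAt_unitGradient h.mem).continuousAt.sub continuousAt_const).norm
    exact this.eventually_lt_const (by simpa [heq] using hκη)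
  refine ⟨V₁ ∩ V₂ ∩ {y | ‖unitGradient φ y - e‖ < 1 - (κ : ℝ)⁻¹} ∩ U,
    inter_mem (inter_mem (inter_mem hV₁ hV₂) hV₃) (h.isOpen.mem_nhds h.mem), fun A hA => ?_⟩
  rw [← heq] at hflat
  have hnormal : ∀ y ∈ A, outerNormal Ω y = unitGradient φ y := fun y hy =>
    (h.center (hA hy).1.2).outerNormal_eq (hA hy).2
  set P := (tangentSpace Ω x).orthogonalProjectionOnto with hP
  have hsec : ∀ y ∈ A, ∀ z ∈ A, |inner ℝ e (y - z)| ≤ η * ‖y - z‖ := fun y hy z hz =>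
    hflat y ⟨(hA hy).1.1.1.1, (hA hy).2⟩ z ⟨(hA hz).1.1.1.1, (hA hz).2⟩
  have hanti : ∀ y ∈ A, ∀ z ∈ A, ‖y - z‖ ≤ κ * ‖P (y - z)‖ := fun y hy z hz =>
    norm_le_mul_norm_orthogonalProjectionOnto he1 hκ0 ((hsec y hy z hz).trans
      (mul_le_mul_of_nonneg_right (min_le_left _ _) (norm_nonneg _)))
  have hinj : InjOn P A := fun y hy z hz hyz => by
    have := hanti y hy z hz
    rw [map_sub, hyz, sub_self, norm_zero, mul_zero] at this
    exact sub_eq_zero.1 (norm_le_zero_iff.1 this)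
  -- The parametrization of `A` by its projection.
  set g := Function.invFunOn P A with hg
  have hgP : ∀ y ∈ A, g (P y) = y := fun y hy => hinj.leftInvOn_invFunOn hy
  -- The Gauss map read in the tangent space.
  set f : tangentSpace Ω x → tangentSpace Ω x := fun w => P (unitGradient φ (g w)) with hf
  have hfapp : ApproximatesLinearOn f (weingartenMap Ω x) (P '' A) δ := by
    rintro _ ⟨y, hy, rfl⟩ _ ⟨z, hz, rfl⟩
    have hW : weingartenMap Ω x (P y - P z) = P (D (P (y - z))) := by
      ext1
      rw [hcoeW, ← map_sub]
      exact (Submodule.starProjection_eq_self_iff.2 (hTmem _ (hDT _))).symm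
    have hPv : ((P (y - z) : tangentSpace Ω x) : EuclideanSpace ℝ (Fin n)) =
        (y - z) - inner ℝ e (y - z) • e :=
      coe_orthogonalProjectionOnto_orthogonal_singleton he1 _
    rw [hf]
    simp only [hgP y hy, hgP z hz]
    rw [hW, ← map_sub, ← map_sub, ← map_sub]
    refine ((tangentSpace Ω x).norm_orthogonalProjectionOnto_apply_le _).trans ?_
    rw [hPv, map_sub D, map_smul, sub_sub_eq_add_sub, add_sub_right_comm]
    have h1 := happ y (hA hy).1.1.1.2 z (hA hz).1.1.1.2
    have h2 : ‖inner ℝ e (y - z) • D e‖ ≤ δ / 4 * ‖y - z‖ := by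
      rw [norm_smul, Real.norm_eq_abs]
      have h3 : ‖D e‖ ≤ ‖D‖ := by simpa [he1] using D.le_opNorm e
      have h4 : η * (‖D‖ + 1) ≤ δ / 4 := by
        refine (mul_le_mul_of_nonneg_right (min_le_right _ _) (by positivity)).trans_eq ?_
        field_simp
      calc |inner ℝ e (y - z)| * ‖D e‖ ≤ (η * ‖y - z‖) * (‖D‖ + 1) := by
            gcongr
            · exact hsec y hy z hz
            · linarith
        _ = (η * (‖D‖ + 1)) * ‖y - z‖ := by ring
        _ ≤ _ := by gcongr
    have h5 : ‖y - z‖ ≤ 2 * ‖P (y - z)‖ := (hanti y hy z hz).trans (by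
      gcongr
      exact_mod_cast hκ2.le)
    refine (norm_add_le _ _).trans ?_
    rw [NNReal.coe_div] at h1
    have h6 : ((4 : ℝ≥0) : ℝ) = 4 := rfl
    rw [h6] at h1
    nlinarith
  have himg : f '' (P '' A) = P '' (outerNormal Ω '' A) := by
    rw [image_image, image_image]
    refine image_congr fun y hy => ?_
    rw [hf]
    simp only [hgP y hy, hnormal y hy]
  have harea := hδ _ _ hfapp
  rw [himg, ← h.euclideanHausdorffMeasure_tangentSpace hx] at harea
  have hsphere : μHE[n - 1] (outerNormal Ω '' A) ≤
      (κ : ENNReal) ^ (n - 1) * μHE[n - 1] (P '' (outerNormal Ω '' A)) := by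
    refine euclideanHausdorffMeasure_le_image_orthogonalProjectionOnto he1 hκ0 ?_ _
    rintro _ ⟨y, hy, rfl⟩ _ ⟨z, hz, rfl⟩
    rw [hnormal y hy, hnormal z hz]
    exact abs_inner_sub_le_of_norm_eq_one (h.norm_unitGradient (hA hy).1.2)
      (h.norm_unitGradient (hA hz).1.2) (hA hy).1.1.2.le (hA hz).1.1.2.le
  calc μHE[n - 1] (outerNormal Ω '' A)
      ≤ (κ : ENNReal) ^ (n - 1) * (m' * μHE[n - 1] (P '' A)) :=
        hsphere.trans (by gcongr)
    _ ≤ (κ : ENNReal) ^ (n - 1) * (m' * μHE[n - 1] A) := by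
        gcongr
        exact euclideanHausdorffMeasure_image_orthogonalProjectionOnto_le _ _ _
    _ = ((κ ^ (n - 1) * m' : ℝ≥0) : ENNReal) * μHE[n - 1] A := by push_cast; ring
    _ ≤ m * μHE[n - 1] A := by gcongr

end IsLocalDefiningFunction

theorem eq_of_inner_nonpos {V : Type*} [NormedAddCommGroup V] [InnerProductSpace ℝ V] {a b : V}
    (ha : ‖a‖ = 1) (hb : ‖b‖ = 1)
    (key : ∀ v, inner ℝ a v < 0 → inner ℝ b v ≤ (0 : ℝ)) : a = b := by
  refine (inner_eq_one_iff_of_norm_eq_one (𝕜 := ℝ) ha hb).1 ?_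
  refine le_antisymm ((real_inner_le_norm a b).trans (by simp [ha, hb])) ?_
  by_contra! hlt
  have hk := key (b - a) (by
    rw [inner_sub_right, real_inner_self_eq_norm_sq, ha]
    linarith)
  rw [inner_sub_right, real_inner_self_eq_norm_sq, hb, real_inner_comm] at hk
  linarith

/-- The Gauss map of a bounded domain with smooth boundary is onto the unit sphere: `u` is the
normal at a point where the linear functional `⟪u, ·⟫` is maximal. -/
theorem image_outerNormal_frontier (hΩ : IsOpen Ω) (hne : Ω.Nonempty)
    (hbdd : Bornology.IsBounded Ω) (hsmooth : HasSmoothBoundary Ω) :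
    outerNormal Ω '' frontier Ω = Metric.sphere 0 1 := by
  refine Subset.antisymm ?_ fun u hu => ?_
  · rintro _ ⟨x, hx, rfl⟩
    obtain ⟨U, φ, h⟩ := hsmooth x hx
    simpa using h.norm_outerNormal hx
  have hu1 : ‖u‖ = 1 := by simpa using hu
  have hcont : Continuous fun y : EuclideanSpace ℝ (Fin n) => (inner ℝ u y : ℝ) := by fun_prop
  obtain ⟨x, hx, hmax⟩ := hbdd.isCompact_closure.exists_isMaxOn hne.closure hcont.continuousOn
  have hmax : ∀ y ∈ closure Ω, inner ℝ u y ≤ (inner ℝ u x : ℝ) := hmax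
  have hxΩ : x ∉ Ω := by
    intro hxΩ
    have hc : ContinuousAt (fun t : ℝ => x + t • u) 0 := by fun_prop
    have hev : ∀ᶠ t in 𝓝[>] (0 : ℝ), x + t • u ∈ Ω :=
      nhdsWithin_le_nhds (hc (by simpa using hΩ.mem_nhds hxΩ))
    obtain ⟨t, ht, ht0⟩ := (hev.and self_mem_nhdsWithin).exists
    have ht0 : 0 < t := ht0
    have := hmax _ (subset_closure ht)
    rw [inner_add_right, inner_smul_right, real_inner_self_eq_norm_sq, hu1] at this
    linarith
  have hxF : x ∈ frontier Ω := by rw [hΩ.frontier_eq]; exact ⟨hx, hxΩ⟩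
  obtain ⟨U, φ, h⟩ := hsmooth x hxF
  refine ⟨x, hxF, eq_of_inner_nonpos (h.norm_outerNormal hxF) hu1 fun v hv => ?_⟩
  have hv' : inner ℝ (gradient φ x) v < 0 := by
    rw [h.gradient_eq_smul_unitGradient h.mem, inner_smul_left, ← h.outerNormal_eq hxF]
    exact mul_neg_of_pos_of_neg (norm_pos_iff.2 (h.gradient_ne_zero x h.mem)) hv
  obtain ⟨t, ht, ht0⟩ := ((h.eventually_add_smul_mem (h.apply_eq_zero hxF) hv').and
    self_mem_nhdsWithin).exists
  have ht0 : 0 < t := ht0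
  have := hmax _ (subset_closure ht)
  rw [inner_add_right, inner_smul_right] at this
  nlinarith

/-! ### The integral inequality -/

theorem continuousOn_meanCurvature (hΩ : IsOpen Ω) (hsmooth : HasSmoothBoundary Ω) :
    ContinuousOn (meanCurvature Ω) (frontier Ω) := by
  intro x hx
  obtain ⟨U, φ, h⟩ := hsmooth x hx
  have h1 : ContinuousAt (fun y => traceCLM n (shapeOperator φ y)) x :=
    (traceCLM n).continuous.continuousAt.comp (h.contDiffAt_shapeOperator h.mem).continuousAt
  refine h1.continuousWithinAt.congr_of_eventuallyEq ?_ (h.meanCurvature_eq hΩ hx)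
  filter_upwards [inter_mem_nhdsWithin (frontier Ω) (h.isOpen.mem_nhds h.mem)] with y hy
  exact (h.center hy.2).meanCurvature_eq hΩ hy.1

theorem continuousOn_meanCurvature_div_pow (hΩ : IsOpen Ω) (hsmooth : HasSmoothBoundary Ω) :
    ContinuousOn (fun x => (meanCurvature Ω x / ((n : ℝ) - 1)) ^ (n - 1)) (frontier Ω) :=
  ((continuousOn_meanCurvature hΩ hsmooth).div_const _).pow _

theorem det_weingartenMap_nonneg (hΩ : IsOpen Ω) (hconv : Convex ℝ Ω)
    (hsmooth : HasSmoothBoundary Ω) (hx : x ∈ frontier Ω) : 0 ≤ (weingartenMap Ω x).det := by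
  obtain ⟨U, φ, h⟩ := hsmooth x hx
  exact (h.weingartenMap_isSymmetric hΩ hx).det_nonneg (h.inner_weingartenMap_nonneg hΩ hconv hx)

/-- The Gauss curvature is at most `(H / (n - 1)) ^ (n - 1)`. -/
theorem det_weingartenMap_le (hn : 2 ≤ n) (hΩ : IsOpen Ω) (hconv : Convex ℝ Ω)
    (hsmooth : HasSmoothBoundary Ω) (hx : x ∈ frontier Ω) :
    (weingartenMap Ω x).det ≤ (meanCurvature Ω x / ((n : ℝ) - 1)) ^ (n - 1) := by
  obtain ⟨U, φ, h⟩ := hsmooth x hx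
  have := (h.weingartenMap_isSymmetric hΩ hx).det_le_trace_div_pow (h.finrank_tangentSpace hx)
    (by omega) (h.inner_weingartenMap_nonneg hΩ hconv hx)
  rwa [Nat.cast_sub (by omega), Nat.cast_one] at this

theorem measure_frontier_lt_top (hbdd : Bornology.IsBounded Ω) (hsmooth : HasSmoothBoundary Ω) :
    μHE[n - 1] (frontier Ω) < ⊤ := by
  have hK : IsCompact (frontier Ω) :=
    hbdd.isCompact_closure.of_isClosed_subset isClosed_frontier frontier_subset_closure
  refine hK.measure_lt_top_of_nhdsWithin fun x hx => ?_
  obtain ⟨U, φ, h⟩ := hsmooth x hx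
  obtain ⟨V, hV, hV'⟩ := h.exists_measure_inter_frontier_lt_top hx
  exact ⟨V ∩ frontier Ω, inter_mem (mem_nhdsWithin_of_mem_nhds hV) self_mem_nhdsWithin, hV'⟩

/-- The area of the Gauss image of a piece of the boundary is at most the integral of
`(H / (n - 1)) ^ (n - 1)` over it. -/
theorem measure_image_outerNormal_le (hn : 2 ≤ n) (hΩ : IsOpen Ω) (hconv : Convex ℝ Ω)
    (hbdd : Bornology.IsBounded Ω) (hsmooth : HasSmoothBoundary Ω)
    {B : Set (EuclideanSpace ℝ (Fin n))} (hBF : B ⊆ frontier Ω) (hB : MeasurableSet B) :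
    μHE[n - 1] (outerNormal Ω '' B) ≤
      ∫⁻ x in B, ENNReal.ofReal ((meanCurvature Ω x / ((n : ℝ) - 1)) ^ (n - 1)) ∂μHE[n - 1] := by
  refine measure_image_le_setLIntegral
    (hbdd.isCompact_closure.of_isClosed_subset isClosed_frontier frontier_subset_closure)
    (measure_frontier_lt_top hbdd hsmooth).ne (continuousOn_meanCurvature_div_pow hΩ hsmooth)
    (fun x hx m hm => ?_) hBF hB
  obtain ⟨U, φ, h⟩ := hsmooth x hx
  refine h.exists_measure_image_outerNormal_le hΩ hx (lt_of_le_of_lt ?_ hm)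
  rw [abs_of_nonneg (det_weingartenMap_nonneg hΩ hconv hsmooth hx)]
  exact ENNReal.ofReal_le_ofReal (det_weingartenMap_le hn hΩ hconv hsmooth hx)

theorem integral_eq_toReal_lintegral (hn : 2 ≤ n) (hΩ : IsOpen Ω) (hconv : Convex ℝ Ω)
    (hsmooth : HasSmoothBoundary Ω) :
    ∫ x in frontier Ω, (meanCurvature Ω x / ((n : ℝ) - 1)) ^ (n - 1) ∂μHE[n - 1] =
      (∫⁻ x in frontier Ω,
        ENNReal.ofReal ((meanCurvature Ω x / ((n : ℝ) - 1)) ^ (n - 1)) ∂μHE[n - 1]).toReal := by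
  have hF : MeasurableSet (frontier Ω) := isClosed_frontier.measurableSet
  refine integral_eq_lintegral_of_nonneg_ae ?_
    ((continuousOn_meanCurvature_div_pow hΩ hsmooth).aestronglyMeasurable hF)
  filter_upwards [ae_restrict_mem hF] with x hx
  exact (det_weingartenMap_nonneg hΩ hconv hsmooth hx).trans
    (det_weingartenMap_le hn hΩ hconv hsmooth hx)

theorem lintegral_lt_top (hΩ : IsOpen Ω) (hbdd : Bornology.IsBounded Ω)
    (hsmooth : HasSmoothBoundary Ω) :
    ∫⁻ x in frontier Ω,
      ENNReal.ofReal ((meanCurvature Ω x / ((n : ℝ) - 1)) ^ (n - 1)) ∂μHE[n - 1] < ⊤ := by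
  have hK : IsCompact (frontier Ω) :=
    hbdd.isCompact_closure.of_isClosed_subset isClosed_frontier frontier_subset_closure
  obtain ⟨C, hC⟩ := hK.exists_bound_of_continuousOn (continuousOn_meanCurvature_div_pow hΩ hsmooth)
  refine (setLIntegral_mono' (g := fun _ => ENNReal.ofReal C) isClosed_frontier.measurableSet
    fun x hx => ENNReal.ofReal_le_ofReal ((le_abs_self _).trans (hC x hx))).trans_lt ?_
  rw [setLIntegral_const]
  exact ENNReal.mul_lt_top ENNReal.ofReal_lt_top (measure_frontier_lt_top hbdd hsmooth)

theorem measure_sphere_le_integral (hn : 2 ≤ n) (hΩ : IsOpen Ω) (hne : Ω.Nonempty)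
    (hconv : Convex ℝ Ω) (hbdd : Bornology.IsBounded Ω) (hsmooth : HasSmoothBoundary Ω) :
    (μHE[n - 1]).real (Metric.sphere (0 : EuclideanSpace ℝ (Fin n)) 1) ≤
      ∫ x in frontier Ω, (meanCurvature Ω x / ((n : ℝ) - 1)) ^ (n - 1) ∂μHE[n - 1] := by
  rw [integral_eq_toReal_lintegral hn hΩ hconv hsmooth, Measure.real,
    ← image_outerNormal_frontier hΩ hne hbdd hsmooth]
  exact ENNReal.toReal_mono (lintegral_lt_top hΩ hbdd hsmooth).ne
    (measure_image_outerNormal_le hn hΩ hconv hbdd hsmooth le_rfl isClosed_frontier.measurableSet)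

/-- In the equality case the arithmetic-geometric mean inequality between the principal curvatures
is an equality at every boundary point: otherwise it would be strict on a set of positive
measure. -/
theorem det_weingartenMap_eq_of_integral_eq (hn : 2 ≤ n) (hΩ : IsOpen Ω) (hne : Ω.Nonempty)
    (hconv : Convex ℝ Ω) (hbdd : Bornology.IsBounded Ω) (hsmooth : HasSmoothBoundary Ω)
    (heq : (μHE[n - 1]).real (Metric.sphere (0 : EuclideanSpace ℝ (Fin n)) 1) =
      ∫ x in frontier Ω, (meanCurvature Ω x / ((n : ℝ) - 1)) ^ (n - 1) ∂μHE[n - 1])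
    (hx : x ∈ frontier Ω) :
    (weingartenMap Ω x).det = (meanCurvature Ω x / ((n : ℝ) - 1)) ^ (n - 1) := by
  refine (det_weingartenMap_le hn hΩ hconv hsmooth hx).eq_of_not_lt fun hlt => ?_
  have hdet := det_weingartenMap_nonneg hΩ hconv hsmooth hx
  set M : EuclideanSpace ℝ (Fin n) → ℝ :=
    fun x => (meanCurvature Ω x / ((n : ℝ) - 1)) ^ (n - 1) with hM
  obtain ⟨U, φ, h⟩ := hsmooth x hx
  have hlt' : ENNReal.ofReal (weingartenMap Ω x).det < ENNReal.ofReal (M x) :=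
    (ENNReal.ofReal_lt_ofReal_iff (hdet.trans_lt hlt)).2 hlt
  obtain ⟨m, hm1, hm2⟩ := ENNReal.lt_iff_exists_nnreal_btwn.1 hlt'
  obtain ⟨m₂, hm2, hm3⟩ := ENNReal.lt_iff_exists_nnreal_btwn.1 hm2
  obtain ⟨V, hV, hV'⟩ := h.exists_measure_image_outerNormal_le hΩ hx (m := m)
    (by rwa [abs_of_nonneg hdet])
  have hMc : ∀ᶠ y in 𝓝[frontier Ω] x, (m₂ : ENNReal) < ENNReal.ofReal (M y) :=
    (ENNReal.continuous_ofReal.continuousAt.comp_continuousWithinAt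
      (continuousOn_meanCurvature_div_pow hΩ hsmooth x hx)).eventually_const_lt hm3
  obtain ⟨W, hW, hWM⟩ := mem_nhdsWithin_iff_exists_mem_nhds_inter.1 hMc
  obtain ⟨O, hO, hOo, hxO⟩ := mem_nhds_iff.1 (inter_mem hV hW)
  have hF : MeasurableSet (frontier Ω) := isClosed_frontier.measurableSet
  have hpos := h.measure_inter_frontier_pos hΩ hx (hOo.mem_nhds hxO)
  have hfin := (measure_mono inter_subset_right).trans_lt (measure_frontier_lt_top hbdd hsmooth)
    (a := μHE[n - 1] (O ∩ frontier Ω))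
  have hA : μHE[n - 1] (outerNormal Ω '' (O ∩ frontier Ω)) <
      ∫⁻ x in O ∩ frontier Ω, ENNReal.ofReal (M x) ∂μHE[n - 1] := by
    calc μHE[n - 1] (outerNormal Ω '' (O ∩ frontier Ω)) ≤ m * μHE[n - 1] (O ∩ frontier Ω) :=
          hV' _ fun a ha => ⟨(hO ha.1).1, ha.2⟩
      _ < m₂ * μHE[n - 1] (O ∩ frontier Ω) :=
          ENNReal.mul_lt_mul_left hpos.ne' hfin.ne hm2
      _ = ∫⁻ x in O ∩ frontier Ω, (m₂ : ENNReal) ∂μHE[n - 1] := (setLIntegral_const _ _).symm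
      _ ≤ _ := setLIntegral_mono' (hOo.measurableSet.inter hF) fun y hy =>
          (hWM ⟨(hO hy.1).2, hy.2⟩).le
  have hB := measure_image_outerNormal_le hn hΩ hconv hbdd hsmooth (B := frontier Ω \ O)
    sdiff_subset (hF.diff hOo.measurableSet)
  -- The estimate is strict on the piece in `O` and holds weakly on the rest of the boundary.
  have hlt2 : μHE[n - 1] (outerNormal Ω '' frontier Ω) <
      ∫⁻ x in frontier Ω, ENNReal.ofReal (M x) ∂μHE[n - 1] := by
    have hsplit : frontier Ω = (O ∩ frontier Ω) ∪ (frontier Ω \ O) := by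
      rw [inter_comm, inter_union_sdiff]
    conv_rhs => rw [hsplit]
    rw [lintegral_union (hF.diff hOo.measurableSet)
      (disjoint_sdiff_inter.symm.mono_left (by rw [inter_comm]))]
    conv_lhs => rw [hsplit]
    rw [image_union]
    have hBfin : ∫⁻ x in frontier Ω \ O, ENNReal.ofReal (M x) ∂μHE[n - 1] ≠ ⊤ :=
      ((lintegral_mono_set sdiff_subset).trans_lt (lintegral_lt_top hΩ hbdd hsmooth)).ne
    exact (measure_union_le _ _).trans_lt
      (ENNReal.add_lt_add_of_lt_of_le (ne_top_of_le_ne_top hBfin hB) hA hB)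
  rw [image_outerNormal_frontier hΩ hne hbdd hsmooth] at hlt2
  rw [integral_eq_toReal_lintegral hn hΩ hconv hsmooth, Measure.real] at heq
  exact absurd heq (ENNReal.toReal_strict_mono (lintegral_lt_top hΩ hbdd hsmooth).ne hlt2).ne

/-! ### Functions on the boundary with vanishing derivative -/

theorem exists_ne_zero_inner_eq_zero (hn : 3 ≤ n) (a b : EuclideanSpace ℝ (Fin n)) :
    ∃ u : EuclideanSpace ℝ (Fin n), u ≠ 0 ∧ inner ℝ a u = 0 ∧ inner ℝ b u = 0 := by
  classical
  set S := Submodule.span ℝ ((({a, b} : Finset (EuclideanSpace ℝ (Fin n))) : Finset _) :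
    Set (EuclideanSpace ℝ (Fin n))) with hS
  have h1 : Module.finrank ℝ S ≤ 2 := (finrank_span_finset_le_card _).trans Finset.card_le_two
  have h2 := Submodule.finrank_add_finrank_orthogonal S
  rw [finrank_euclideanSpace_fin] at h2
  have h3 : Sᗮ ≠ ⊥ := fun h => by
    rw [h, finrank_bot] at h2
    omega
  obtain ⟨u, hu, hu0⟩ := Submodule.exists_mem_ne_zero_of_ne_bot h3
  exact ⟨u, hu0, hu a (Submodule.subset_span (by simp)), hu b (Submodule.subset_span (by simp))⟩

section Gauge

variable {V : Type*} [NormedAddCommGroup V] [NormedSpace ℝ V] {s : Set V}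

theorem inv_gauge_smul_mem_frontier (hconv : Convex ℝ s) (hs : s ∈ 𝓝 0)
    (hbdd : Bornology.IsBounded s) {v : V} (hv : v ≠ 0) : (gauge s v)⁻¹ • v ∈ frontier s := by
  have hpos : 0 < gauge s v :=
    (gauge_pos (absorbent_nhds_zero hs) ((NormedSpace.isVonNBounded_iff ℝ).2 hbdd)).2 hv
  rw [← gauge_eq_one_iff_mem_frontier hconv hs, gauge_smul_of_nonneg (inv_nonneg.2 hpos.le),
    smul_eq_mul, inv_mul_cancel₀ hpos.ne']

/-- The radial projection of a differentiable curve avoiding the origin to the boundary of a convex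
body varies at most linearly, as the gauge is Lipschitz. -/
theorem isBigO_inv_gauge_smul_sub (hconv : Convex ℝ s) (hs : s ∈ 𝓝 0)
    (hbdd : Bornology.IsBounded s) {z : ℝ → V} {t : ℝ} (hz : DifferentiableAt ℝ z t)
    (hz0 : z t ≠ 0) :
    (fun u => (gauge s (z u))⁻¹ • z u - (gauge s (z t))⁻¹ • z t) =O[𝓝 t] fun u => u - t := by
  have hpos : 0 < gauge s (z t) :=
    (gauge_pos (absorbent_nhds_zero hs) ((NormedSpace.isVonNBounded_iff ℝ).2 hbdd)).2 hz0
  obtain ⟨r, hr, hball⟩ := Metric.mem_nhds_iff.1 hs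
  have hlip := hconv.lipschitzWith_gauge (r := ⟨r, hr.le⟩) hr hball
  have hzO : (fun u => z u - z t) =O[𝓝 t] fun u => u - t := hz.isBigO_sub
  have hcont : ContinuousAt (fun u => gauge s (z u)) t :=
    hlip.continuous.continuousAt.comp hz.continuousAt
  have hinv : ContinuousAt (fun u => (gauge s (z u))⁻¹) t := hcont.inv₀ hpos.ne'
  have hbd : (fun u => (gauge s (z u))⁻¹) =O[𝓝 t] fun _ => (1 : ℝ) := hinv.isBigO_one ℝ
  have hgO : (fun u => gauge s (z t) - gauge s (z u)) =O[𝓝 t] fun u => u - t := by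
    refine (Asymptotics.IsBigO.of_bound r⁻¹ (Eventually.of_forall fun u => ?_)).trans hzO
    rw [← dist_eq_norm, ← dist_eq_norm, dist_comm]
    exact hlip.dist_le_mul _ _
  have h1 : (fun u => (gauge s (z u))⁻¹ • (z u - z t)) =O[𝓝 t] fun u => u - t := by
    simpa using hbd.smul hzO
  have h2 : (fun u => ((gauge s (z u))⁻¹ * (gauge s (z t) - gauge s (z u))) •
      ((gauge s (z t))⁻¹ • z t)) =O[𝓝 t] fun u => u - t := by
    have h3 := (hbd.mul hgO).smul
      (Asymptotics.isBigO_refl (fun _ : ℝ => (gauge s (z t))⁻¹ • z t) (𝓝 t))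
    refine h3.trans ?_
    simp only [one_mul]
    refine Asymptotics.IsBigO.of_bound ‖(gauge s (z t))⁻¹ • z t‖ (Eventually.of_forall fun u => ?_)
    rw [norm_smul, mul_comm]
  refine (h1.add h2).congr' ?_ EventuallyEq.rfl
  filter_upwards [hcont.eventually_ne hpos.ne'] with u hu
  rw [smul_smul, smul_sub, sub_add, ← sub_smul]
  congr 2
  field_simp
  ring

end Gauge

/-- A function on the boundary of a bounded convex domain that is constant to first order at each
point is constant. It is constant along the radial projection to the boundary of the segment between
two points in orthogonal directions, and any two points have a third one orthogonal to both. -/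
theorem eq_of_hasFDerivWithinAt_zero (hn : 3 ≤ n) (hΩ : IsOpen Ω) (hne : Ω.Nonempty)
    (hconv : Convex ℝ Ω) (hbdd : Bornology.IsBounded Ω)
    {G : Type*} [NormedAddCommGroup G] [NormedSpace ℝ G] {g : EuclideanSpace ℝ (Fin n) → G}
    (hg : ∀ x ∈ frontier Ω,
      HasFDerivWithinAt g (0 : EuclideanSpace ℝ (Fin n) →L[ℝ] G) (frontier Ω) x)
    (hx : x ∈ frontier Ω) (hy : y ∈ frontier Ω) : g x = g y := by
  obtain ⟨c, hc⟩ := hne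
  -- Moving `c` to the origin makes the gauge of the domain available.
  set s : Set (EuclideanSpace ℝ (Fin n)) := (fun v => c + v) ⁻¹' Ω with hs
  have hs0 : s ∈ 𝓝 0 :=
    (hΩ.preimage (by fun_prop : Continuous fun v => c + v)).mem_nhds (by simpa [hs] using hc)
  have hsconv : Convex ℝ s := hconv.translate_preimage_right c
  have hsbdd : Bornology.IsBounded s := by
    have : s = (IsometryEquiv.addLeft c) ⁻¹' Ω := rfl
    rw [this]
    exact (IsometryEquiv.addLeft c).isometry.antilipschitz.isBounded_preimage hbdd
  have hsF : ∀ v, v ∈ frontier s ↔ c + v ∈ frontier Ω := fun v => by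
    have : frontier s = (Homeomorph.addLeft c) ⁻¹' frontier Ω :=
      ((Homeomorph.addLeft c).preimage_frontier Ω).symm
    rw [this]
    rfl
  have h0F : (0 : EuclideanSpace ℝ (Fin n)) ∉ frontier s := by
    rw [hsF, add_zero, hΩ.frontier_eq]
    exact fun h => h.2 hc
  have horth : ∀ v ∈ frontier s, ∀ w ∈ frontier s, inner ℝ v w = 0 → g (c + v) = g (c + w) := by
    intro v hv w hw hvw
    have hv0 : v ≠ 0 := fun h => h0F (h ▸ hv)
    have hw0 : w ≠ 0 := fun h => h0F (h ▸ hw)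
    set z : ℝ → EuclideanSpace ℝ (Fin n) := fun t => (1 - t) • v + t • w with hz
    have hz0 : ∀ t, z t ≠ 0 := by
      intro t ht
      have h1 : inner ℝ v (z t) = (1 - t) * ‖v‖ ^ 2 := by
        rw [hz]
        simp only [inner_add_right, inner_smul_right, hvw, real_inner_self_eq_norm_sq]
        ring
      have h2 : inner ℝ w (z t) = t * ‖w‖ ^ 2 := by
        rw [hz]
        simp only [inner_add_right, inner_smul_right, real_inner_comm, hvw,
          real_inner_self_eq_norm_sq]
        ring
      rw [ht, inner_zero_right] at h1 h2
      have h3 : t = 0 := by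
        simpa [hw0] using h2.symm
      rw [h3, sub_zero, one_mul] at h1
      exact (pow_pos (norm_pos_iff.2 hv0) 2).ne h1
    have hzd : ∀ t, DifferentiableAt ℝ z t := fun t => by
      rw [hz]
      fun_prop
    set γ : ℝ → EuclideanSpace ℝ (Fin n) := fun t => c + (gauge s (z t))⁻¹ • z t with hγ
    have hγF : ∀ t, γ t ∈ frontier Ω := fun t =>
      (hsF _).1 (inv_gauge_smul_mem_frontier hsconv hs0 hsbdd (hz0 t))
    have hγO : ∀ t, (fun u => γ u - γ t) =O[𝓝 t] fun u => u - t := fun t => by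
      have := isBigO_inv_gauge_smul_sub hsconv hs0 hsbdd (hzd t) (hz0 t)
      simpa [hγ] using this
    have hder : ∀ t, HasDerivAt (g ∘ γ) 0 t := by
      intro t
      have hlim : Tendsto γ (𝓝 t) (𝓝[frontier Ω] γ t) := by
        refine tendsto_nhdsWithin_iff.2 ⟨?_, Eventually.of_forall hγF⟩
        rw [tendsto_iff_norm_sub_tendsto_zero]
        have h1 : Tendsto (fun u : ℝ => u - t) (𝓝 t) (𝓝 0) := by
          have : Continuous fun u : ℝ => u - t := by fun_prop
          simpa using this.tendsto t
        exact ((hγO t).trans_tendsto h1).norm.trans (by simp)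
      have h2 := (hasFDerivWithinAt_iff_isLittleO.1 (hg (γ t) (hγF t))).comp_tendsto hlim
      rw [hasDerivAt_iff_isLittleO]
      simpa [Function.comp_def] using h2.trans_isBigO (hγO t)
    have hconst := is_const_of_deriv_eq_zero (fun t => (hder t).differentiableAt)
      (fun t => (hder t).deriv) 0 1
    have hv1 := (gauge_eq_one_iff_mem_frontier hsconv hs0).2 hv
    have hw1 := (gauge_eq_one_iff_mem_frontier hsconv hs0).2 hw
    simpa [hγ, hz, hv1, hw1] using hconst
  obtain ⟨u, hu0, hxu, hyu⟩ := exists_ne_zero_inner_eq_zero hn (x - c) (y - c)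
  have hu := inv_gauge_smul_mem_frontier hsconv hs0 hsbdd hu0
  have h1 := horth (x - c) ((hsF _).2 (by simpa using hx)) _ hu
    (by rw [inner_smul_right, hxu, mul_zero])
  have h2 := horth (y - c) ((hsF _).2 (by simpa using hy)) _ hu
    (by rw [inner_smul_right, hyu, mul_zero])
  simpa using h1.trans h2.symm

/-! ### Balls -/

theorem eq_ball_of_frontier_eq_sphere (hn : 2 ≤ n) (hΩ : IsOpen Ω) (hconv : Convex ℝ Ω)
    {c : EuclideanSpace ℝ (Fin n)} {r : ℝ}
    (hr : 0 < r) (hF : frontier Ω = Metric.sphere c r) : Ω = Metric.ball c r := by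
  have : Nontrivial (EuclideanSpace ℝ (Fin n)) :=
    Module.nontrivial_of_finrank_pos (R := ℝ) (by rw [finrank_euclideanSpace_fin]; omega)
  have hcΩ : c ∈ Ω := by
    have h1 : c ∈ closure Ω := by
      obtain ⟨u, hu⟩ := exists_norm_eq (EuclideanSpace ℝ (Fin n)) hr.le
      have hp : c + u ∈ closure Ω := frontier_subset_closure (by rw [hF]; simp [hu])
      have hm : c - u ∈ closure Ω := frontier_subset_closure (by rw [hF]; simp [hu])
      have := hconv.closure hp hm (by norm_num : (0 : ℝ) ≤ 1 / 2) (by norm_num : (0 : ℝ) ≤ 1 / 2)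
        (by norm_num)
      convert this using 1
      module
    by_contra hc
    have : c ∈ frontier Ω := by rw [hΩ.frontier_eq]; exact ⟨h1, hc⟩
    rw [hF] at this
    simp [hr.ne] at this
  refine Subset.antisymm ?_ ?_
  · refine hconv.isPreconnected.subset_of_closure_inter_subset Metric.isOpen_ball
      ⟨c, hcΩ, Metric.mem_ball_self hr⟩ fun y hy => ?_
    by_contra hyb
    have hyF : y ∈ frontier (Metric.ball c r) := by
      rw [Metric.isOpen_ball.frontier_eq]
      exact ⟨hy.1, hyb⟩
    rw [frontier_ball c hr.ne', ← hF, hΩ.frontier_eq] at hyF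
    exact hyF.2 hy.2
  · refine (convex_ball c r).isPreconnected.subset_of_closure_inter_subset hΩ
      ⟨c, Metric.mem_ball_self hr, hcΩ⟩ fun y hy => ?_
    by_contra hyΩ
    have hyF : y ∈ frontier Ω := by
      rw [hΩ.frontier_eq]
      exact ⟨hy.1, hyΩ⟩
    rw [hF] at hyF
    exact (Metric.mem_ball.1 hy.2).ne hyF

/-- The support inequality at the boundary point `c + r N`, with `N` the normal at `x`, forces
`N` to be the radial direction of `x`. -/
theorem outerNormal_ball {c : EuclideanSpace ℝ (Fin n)} {r : ℝ} (hr : 0 < r)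
    (h : IsLocalDefiningFunction (Metric.ball c r) x U φ)
    (hx : x ∈ frontier (Metric.ball c r)) :
    outerNormal (Metric.ball c r) x = r⁻¹ • (x - c) := by
  have hN := h.norm_outerNormal hx
  set N := outerNormal (Metric.ball c r) x with hNdef
  have hxr : ‖x - c‖ = r := by
    rw [frontier_ball c hr.ne'] at hx
    simpa [dist_eq_norm] using hx
  have h1 := h.inner_unitGradient_sub_nonpos Metric.isOpen_ball (convex_ball c r) hx
    (y := c + r • N) (by
      rw [closure_ball c hr.ne']
      simp [norm_smul, hN, abs_of_pos hr])
  rw [← h.outerNormal_eq hx, ← hNdef] at h1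
  have h2 : c + r • N - x = r • N - (x - c) := by abel
  rw [h2, inner_sub_right, inner_smul_right, real_inner_self_eq_norm_sq, hN] at h1
  have hu : ‖r⁻¹ • (x - c)‖ = 1 := by
    rw [norm_smul, hxr, norm_inv, Real.norm_eq_abs, abs_of_pos hr, inv_mul_cancel₀ hr.ne']
  refine (inner_eq_one_iff_of_norm_eq_one (𝕜 := ℝ) hN hu).1 (le_antisymm ?_ ?_)
  · exact (real_inner_le_norm _ _).trans (by rw [hN, hu, one_mul])
  · rw [inner_smul_right, inv_mul_eq_div, le_div_iff₀ hr]
    linarith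

theorem meanCurvature_ball (hn : 1 ≤ n) {c : EuclideanSpace ℝ (Fin n)} {r : ℝ} (hr : 0 < r)
    (hsmooth : HasSmoothBoundary (Metric.ball c r)) (hx : x ∈ frontier (Metric.ball c r)) :
    meanCurvature (Metric.ball c r) x = ((n : ℝ) - 1) * r⁻¹ := by
  obtain ⟨U, φ, h⟩ := hsmooth x hx
  have hid : HasFDerivAt (fun y => r⁻¹ • (y - c))
      (r⁻¹ • ContinuousLinearMap.id ℝ (EuclideanSpace ℝ (Fin n))) x :=
    ((hasFDerivAt_id x).sub_const c).const_smul r⁻¹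
  have hW : (weingartenMap (Metric.ball c r) x).toLinearMap = r⁻¹ • LinearMap.id := by
    ext v : 2
    rw [ContinuousLinearMap.coe_coe, h.coe_weingartenMap Metric.isOpen_ball hx]
    have h1 := h.fderiv_apply_eq_zero Metric.isOpen_ball hx
      ((h.hasFDerivWithinAt_outerNormal hx).sub hid.hasFDerivWithinAt) (by
        filter_upwards [inter_mem_nhdsWithin _ (h.isOpen.mem_nhds h.mem)] with y hy
        simp [outerNormal_ball hr (h.center hy.2) hy.1])
      ((h.mem_tangentSpace_iff hx).1 v.2)
    simpa [sub_eq_zero] using h1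
  rw [meanCurvature, hW, map_smul, LinearMap.trace_id, h.finrank_tangentSpace hx,
    Nat.cast_sub hn, smul_eq_mul, mul_comm, Nat.cast_one]

open scoped Pointwise in
theorem measure_sphere_eq_integral_ball (hn : 2 ≤ n) {c : EuclideanSpace ℝ (Fin n)} {r : ℝ}
    (hr : 0 < r) (hsmooth : HasSmoothBoundary (Metric.ball c r)) :
    (μHE[n - 1]).real (Metric.sphere (0 : EuclideanSpace ℝ (Fin n)) 1) =
      ∫ x in frontier (Metric.ball c r),
        (meanCurvature (Metric.ball c r) x / ((n : ℝ) - 1)) ^ (n - 1) ∂μHE[n - 1] := by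
  have hn' : (n : ℝ) - 1 ≠ 0 := by
    have : (2 : ℝ) ≤ n := by exact_mod_cast hn
    linarith
  have h1 : ∀ x ∈ frontier (Metric.ball c r),
      (meanCurvature (Metric.ball c r) x / ((n : ℝ) - 1)) ^ (n - 1) = (r ^ (n - 1))⁻¹ := by
    intro x hx
    rw [meanCurvature_ball (by omega) hr hsmooth hx, mul_div_cancel_left₀ _ hn', inv_pow]
  have h2 : μHE[n - 1] (Metric.sphere c r) =
      ‖r‖₊ ^ (n - 1) • μHE[n - 1] (Metric.sphere (0 : EuclideanSpace ℝ (Fin n)) 1) := by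
    have h3 : (IsometryEquiv.addLeft c) '' (r • Metric.sphere (0 : EuclideanSpace ℝ (Fin n)) 1) =
        Metric.sphere c r := by
      rw [smul_sphere' hr.ne', IsometryEquiv.image_sphere]
      simp [abs_of_pos hr]
    rw [← h3, (IsometryEquiv.addLeft c).isometry.euclideanHausdorffMeasure_image,
      Measure.euclideanHausdorffMeasure_smul₀ _ hr.ne']
  rw [setIntegral_congr_fun isClosed_frontier.measurableSet h1, setIntegral_const,
    frontier_ball c hr.ne', Measure.real, Measure.real, h2, ENNReal.toReal_smul, smul_eq_mul,
    NNReal.smul_def, smul_eq_mul]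
  simp only [NNReal.coe_pow, coe_nnnorm, Real.norm_eq_abs, abs_of_pos hr]
  field_simp

/-! ### Totally umbilical boundaries -/

/-- The boundary is totally umbilical: at each point the Weingarten map is a multiple of the
identity, the factor being the mean `H / (n - 1)` of the principal curvatures. -/
def IsUmbilical (Ω : Set (EuclideanSpace ℝ (Fin n))) : Prop :=
  ∀ x ∈ frontier Ω, ∀ v : tangentSpace Ω x,
    weingartenMap Ω x v = (meanCurvature Ω x / ((n : ℝ) - 1)) • v

theorem isUmbilical_of_det_eq (hn : 2 ≤ n) (hΩ : IsOpen Ω) (hconv : Convex ℝ Ω)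
    (hsmooth : HasSmoothBoundary Ω)
    (hdet : ∀ x ∈ frontier Ω,
      (weingartenMap Ω x).det = (meanCurvature Ω x / ((n : ℝ) - 1)) ^ (n - 1)) :
    IsUmbilical Ω := by
  intro x hx v
  obtain ⟨U, φ, h⟩ := hsmooth x hx
  have hcast : ((n - 1 : ℕ) : ℝ) = (n : ℝ) - 1 := by rw [Nat.cast_sub (by omega), Nat.cast_one]
  have := (h.weingartenMap_isSymmetric hΩ hx).apply_eq_smul_of_det_eq (h.finrank_tangentSpace hx)
    (by omega) (h.inner_weingartenMap_nonneg hΩ hconv hx) (by rw [hcast]; exact hdet x hx) v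
  rwa [hcast] at this

namespace IsUmbilical

theorem fderiv_unitGradient_apply (hu : IsUmbilical Ω) (hΩ : IsOpen Ω)
    (h : IsLocalDefiningFunction Ω x U φ) (hx : x ∈ frontier Ω) {v : EuclideanSpace ℝ (Fin n)}
    (hv : inner ℝ (unitGradient φ x) v = 0) :
    fderiv ℝ (unitGradient φ) x v = (meanCurvature Ω x / ((n : ℝ) - 1)) • v := by
  have h1 := h.coe_weingartenMap hΩ hx ⟨v, (h.mem_tangentSpace_iff hx).2 hv⟩
  rw [hu x hx] at h1
  exact h1.symm

/-- The principal curvature of a totally umbilical boundary is constant to first order. With `κ` the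
curvature, the identity `D N (P u) = κ P u`, where `P u = u - ⟪N, u⟫ N`, holds along the boundary.
Its derivative in the tangent direction `w` reads `D² N (w, u) - (D κ w) u = b(w, u)` with `b`
symmetric, hence `(D κ w) u = (D κ u) w`, and `u` may be taken orthogonal to `w`. -/
theorem hasFDerivWithinAt_curvature (hu : IsUmbilical Ω) (hn : 3 ≤ n) (hΩ : IsOpen Ω)
    (hsmooth : HasSmoothBoundary Ω) (hx : x ∈ frontier Ω) :
    HasFDerivWithinAt (fun y => meanCurvature Ω y / ((n : ℝ) - 1))
      (0 : EuclideanSpace ℝ (Fin n) →L[ℝ] ℝ) (frontier Ω) x := by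
  obtain ⟨U, φ, h⟩ := hsmooth x hx
  set N := unitGradient φ with hN
  set κ : EuclideanSpace ℝ (Fin n) → ℝ :=
    fun y => traceCLM n (shapeOperator φ y) / ((n : ℝ) - 1) with hκ
  have hκeq : ∀ y ∈ frontier Ω ∩ U, meanCurvature Ω y / ((n : ℝ) - 1) = κ y := fun y hy => by
    rw [(h.center hy.2).meanCurvature_eq hΩ hy.1]
  have hκd : HasFDerivAt κ (fderiv ℝ κ x) x := by
    have h1 : ContDiffAt ℝ ∞ (fun y => traceCLM n (shapeOperator φ y)) x :=
      (traceCLM n).contDiff.contDiffAt.comp x (h.contDiffAt_shapeOperator h.mem)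
    exact ((h1.div_const _).differentiableAt (by simp)).hasFDerivAt
  have hev : ∀ᶠ y in 𝓝[frontier Ω] x, y ∈ frontier Ω ∩ U :=
    inter_mem_nhdsWithin _ (h.isOpen.mem_nhds h.mem)
  have hN1 : HasFDerivAt N (fderiv ℝ N x) x := h.hasFDerivAt_unitGradient h.mem
  have hN2 : HasFDerivAt (fderiv ℝ N) (fderiv ℝ (fderiv ℝ N) x) x :=
    (((h.contDiffAt_unitGradient h.mem).fderiv_right (m := ∞) (by simp)).differentiableAt
      (by simp)).hasFDerivAt
  have hsymm : IsSymmSndFDerivAt ℝ N x :=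
    ((h.contDiffAt_unitGradient h.mem).of_le (m := 2)
      (WithTop.coe_le_coe.2 le_top)).isSymmSndFDerivAt (by simp)
  -- The derivative along `w` of `D N (P u) - κ P u`.
  have key : ∀ u w, inner ℝ (N x) u = 0 → inner ℝ (N x) w = 0 →
      fderiv ℝ (fderiv ℝ N) x w u - κ x • inner ℝ u w • fderiv ℝ N x (N x) -
        (fderiv ℝ κ x w • u - κ x • κ x • inner ℝ u w • N x) = 0 := by
    intro u w hu0 hw0
    have hq := ((hasFDerivAt_const u x).sub (((hasFDerivAt_const u x).inner ℝ hN1).smul hN1))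
    have hE := (hN2.clm_apply hq).sub (hκd.smul hq)
    have h0 := h.fderiv_apply_eq_zero hΩ hx hE.hasFDerivWithinAt (by
      filter_upwards [hev] with y hy
      have h2 : inner ℝ (N y) (u - inner ℝ u (N y) • N y) = 0 := by
        rw [inner_sub_right, inner_smul_right, real_inner_self_eq_norm_sq,
          h.norm_unitGradient hy.2, real_inner_comm]
        ring
      have h3 := hu.fderiv_unitGradient_apply hΩ (h.center hy.2) hy.1 h2
      rw [hκeq y hy] at h3
      simpa [sub_eq_zero] using h3) hw0
    have hw1 : fderiv ℝ N x w = κ x • w := by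
      rw [← hκeq x ⟨hx, h.mem⟩]
      exact hu.fderiv_unitGradient_apply hΩ h hx hw0
    have hu1 : inner ℝ u (N x) = 0 := by rw [real_inner_comm, hu0]
    simp [hu1, hw1, inner_smul_right, smul_smul] at h0
    rw [← h0]
    module
  have hz : ∀ w, inner ℝ (N x) w = 0 → fderiv ℝ κ x w = 0 := by
    intro w hw0
    obtain ⟨u, hu0, hNu, hwu⟩ := exists_ne_zero_inner_eq_zero hn (N x) w
    have h1 := key u w hNu hw0
    have h2 := key w u hw0 hNu
    rw [hsymm.eq u w, real_inner_comm] at h2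
    have h3 : fderiv ℝ κ x w • u = fderiv ℝ κ x u • w := by
      have := h1.trans h2.symm
      simpa using this
    have h4 := congrArg (fun v => inner ℝ v u) h3
    simpa [inner_smul_left, hwu, hu0] using h4
  refine (h.hasFDerivWithinAt_zero hx hκd.hasFDerivWithinAt hz).congr_of_eventuallyEq ?_
    (hκeq x ⟨hx, h.mem⟩)
  filter_upwards [hev] with y hy using hκeq y hy

/-- A bounded convex domain with totally umbilical boundary is a ball. -/
theorem exists_eq_ball (hu : IsUmbilical Ω) (hn : 3 ≤ n) (hΩ : IsOpen Ω) (hne : Ω.Nonempty)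
    (hconv : Convex ℝ Ω) (hbdd : Bornology.IsBounded Ω) (hsmooth : HasSmoothBoundary Ω) :
    ∃ (c : EuclideanSpace ℝ (Fin n)) (r : ℝ), 0 < r ∧ Ω = Metric.ball c r := by
  have himg := image_outerNormal_frontier hΩ hne hbdd hsmooth
  have : Nontrivial (EuclideanSpace ℝ (Fin n)) :=
    Module.nontrivial_of_finrank_pos (R := ℝ) (by rw [finrank_euclideanSpace_fin]; omega)
  obtain ⟨e, he⟩ := exists_norm_eq (EuclideanSpace ℝ (Fin n)) zero_le_one
  have hmem : ∀ u : EuclideanSpace ℝ (Fin n), ‖u‖ = 1 →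
      ∃ x ∈ frontier Ω, outerNormal Ω x = u := fun u hu1 => by
    have : u ∈ outerNormal Ω '' frontier Ω := by rw [himg]; simpa using hu1
    exact this
  obtain ⟨x₀, hx₀, hx₀e⟩ := hmem e he
  set k := meanCurvature Ω x₀ / ((n : ℝ) - 1) with hk
  have hkc : ∀ x ∈ frontier Ω, meanCurvature Ω x / ((n : ℝ) - 1) = k := fun x hx =>
    eq_of_hasFDerivWithinAt_zero hn hΩ hne hconv hbdd
      (fun y hy => hu.hasFDerivWithinAt_curvature hn hΩ hsmooth hy) hx hx₀
  have hpos : ∀ x ∈ frontier Ω, outerNormal Ω x - k • x = e - k • x₀ := by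
    intro x hx
    rw [← hx₀e]
    refine eq_of_hasFDerivWithinAt_zero (g := fun x => outerNormal Ω x - k • x)
      hn hΩ hne hconv hbdd (fun y hy => ?_) hx hx₀
    obtain ⟨U, φ, h⟩ := hsmooth y hy
    refine h.hasFDerivWithinAt_zero hy ((h.hasFDerivWithinAt_outerNormal hy).sub
      ((hasFDerivAt_id y).const_smul k).hasFDerivWithinAt) fun v hv => ?_
    simp [hu.fderiv_unitGradient_apply hΩ h hy hv, hkc y hy]
  have hk0 : k ≠ 0 := by
    intro hk0
    obtain ⟨x₁, hx₁, hx₁e⟩ := hmem (-e) (by rwa [norm_neg])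
    have h1 := hpos x₁ hx₁
    rw [hk0, zero_smul, zero_smul, sub_zero, sub_zero, hx₁e] at h1
    have h2 : (2 : ℝ) • e = 0 := by
      rw [two_smul]
      nth_rewrite 1 [← h1]
      exact neg_add_cancel e
    rw [(smul_eq_zero.1 h2).resolve_left two_ne_zero, norm_zero] at he
    exact zero_ne_one he
  set c := x₀ - k⁻¹ • e with hc
  have hν : ∀ x ∈ frontier Ω, outerNormal Ω x = k • (x - c) := by
    intro x hx
    have h1 := hpos x hx
    rw [sub_eq_iff_eq_add] at h1
    rw [h1, hc, smul_sub, smul_sub, smul_smul, mul_inv_cancel₀ hk0, one_smul]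
    abel
  have hr : 0 < |k⁻¹| := abs_pos.2 (inv_ne_zero hk0)
  have hcenter : ∀ y, y ∈ Metric.sphere c |k⁻¹| ↔ ‖k • (y - c)‖ = 1 := fun y => by
    rw [mem_sphere_iff_norm, norm_smul, Real.norm_eq_abs, abs_inv, mul_comm,
      mul_eq_one_iff_eq_inv₀ (abs_ne_zero.2 hk0)]
  refine ⟨c, |k⁻¹|, hr, eq_ball_of_frontier_eq_sphere (by omega) hΩ hconv hr ?_⟩
  ext y
  rw [hcenter]
  refine ⟨fun hy => ?_, fun hy => ?_⟩
  · obtain ⟨U, φ, h⟩ := hsmooth y hy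
    rw [← hν y hy, h.norm_outerNormal hy]
  · obtain ⟨x, hx, hxy⟩ := hmem _ hy
    rw [hν x hx] at hxy
    have h2 := smul_right_injective _ hk0 hxy
    rwa [← sub_left_inj.1 h2]

end IsUmbilical

end SmoothDomain

theorem mainTheorem8 (n : ℕ) (hn : 3 ≤ n) (Ω : Set (EuclideanSpace ℝ (Fin n)))
    (hopen : IsOpen Ω) (hne : Ω.Nonempty) (hconv : Convex ℝ Ω) (hbdd : Bornology.IsBounded Ω)
    (hsmooth : SmoothDomain.HasSmoothBoundary Ω) :
    (μHE[n - 1]).real (Metric.sphere (0 : EuclideanSpace ℝ (Fin n)) 1) ≤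
        ∫ x in frontier Ω, (SmoothDomain.meanCurvature Ω x / ((n : ℝ) - 1)) ^ (n - 1) ∂μHE[n - 1] ∧
      ((μHE[n - 1]).real (Metric.sphere (0 : EuclideanSpace ℝ (Fin n)) 1) =
          ∫ x in frontier Ω,
            (SmoothDomain.meanCurvature Ω x / ((n : ℝ) - 1)) ^ (n - 1) ∂μHE[n - 1] ↔
        ∃ (c : EuclideanSpace ℝ (Fin n)) (r : ℝ), 0 < r ∧ Ω = Metric.ball c r) := by
  have hn2 : 2 ≤ n := by omega
  refine ⟨SmoothDomain.measure_sphere_le_integral hn2 hopen hne hconv hbdd hsmooth,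
    fun heq => ?_, ?_⟩
  · have hu : SmoothDomain.IsUmbilical Ω :=
      SmoothDomain.isUmbilical_of_det_eq hn2 hopen hconv hsmooth fun x hx =>
        SmoothDomain.det_weingartenMap_eq_of_integral_eq hn2 hopen hne hconv hbdd hsmooth heq hx
    exact hu.exists_eq_ball hn hopen hne hconv hbdd hsmooth
  · rintro ⟨c, r, hr, rfl⟩
    exact SmoothDomain.measure_sphere_eq_integral_ball hn2 hr hsmooth
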